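/- Work in the Blum–Shub–Smale (BSS) model over $(\mathbb{R},+,-,\times,\div,<)$, with arbitrary real machine constants. A decision problem is a set $A\subseteq\mathbb{R}^\infty=\bigcup_k\mathbb{R}^k$ of finite real sequences. $A$ is semi-decidable (recursively enumerable) if some BSS machine halts precisely on the inputs in $A$. $A$ is reducible to $B$, written $A\preceq B$, if some BSS oracle machine with oracle $B$ decides membership in $A$; $A\equiv B$ means $A\preceq B$ and $B\preceq A$. The (real) Turing degrees are the classes $\{B : A\equiv B\}$, ordered by $\preceq$ of representatives; a degree is recursively enumerable if it contains a semi-decidable problem. The real Halting Problem $\mathbb{H}_{\mathbb{R}}$ is: given the code of a BSS machine $M$ (without oracle) and $x\in\mathbb{R}^\infty$, does $M$ terminate on input $x$? For a set $P$ of prime numbers let $$F_P:=\mathbb{Q}\big(\{p^{1/n} : p\in P,\ n\in\mathbb{N},\ n\ge 1\}\big)\subseteq\mathbb{R}$$ (with positive real roots), regarded as a decision problem consisting of sequences of length $1$. Then: 1. For all sets $P,Q$ of primes, $F_P\preceq F_Q$ if and only if $P\subseteq Q$. 2. For every set $P$ of primes, $F_P$ is semi-decidable. 3. Every countable partially ordered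 set admits an order embedding into the recursively enumerable real Turing degrees. 4. Among the degrees of the problems $F_P$ there is an uncountable set of pairwise incomparable recursively enumerable degrees, each of them strictly below the degree of $\mathbb{H}_{\mathbb{R}}$. -/

import Mathlib

noncomputable section

namespace BSS

/-- A real number decision problem (a language): a set of finite sequences of reals. -/
abbrev Problem : Type := Set (List ℝ)

/-- The four arithmetic operations. -/
inductive ArithOp where
  | add | sub | mul | div

/-- What a computation instruction does to a copy-register: it remains unchanged, is
incremented by one, or is replaced by `0`. -/
inductive IndexOp where
  | keep | succ | zero

/-- The instructions of a BSS (oracle) machine over `ℝ`.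
* `arith o s k l u v` : `x_s ← x_k o x_l`, then `u`, `v` are applied to the copy-registers `i`, `j`;
* `const s a u v` : `x_s ← a` for a real constant `a`, then `u`, `v` are applied to `i`, `j`;
* `branch t` : if `x_0 ≥ 0` go to instruction `t`, else go to the next one;
* `copy` : `x_i ← x_j`;
* `query t` : if the sequence held in the registers belongs to the oracle go to instruction `t`,
  else go to the next one. -/
inductive Instr where
  | arith (o : ArithOp) (s k l : ℤ) (u v : IndexOp)
  | const (s : ℤ) (a : ℝ) (u v : IndexOp)
  | branch (t : ℕ)
  | copy
  | query (t : ℕ)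

/-- A machine is given by its finite list of instructions, labelled `0, 1, …, N - 1`. Reaching a
label `≥ N` means that the computation stops. -/
abbrev Program : Type := List Instr

/-- A BSS machine without oracle: no query instruction occurs. -/
def Program.OracleFree (p : Program) : Prop :=
  ∀ t : ℕ, Instr.query t ∉ p

/-- A configuration: the current label, the two copy-registers, and the contents of the real
registers. A finite sequence `y_1, …, y_n` is held with its size `n` in register `0` and with `y_k`
in register `k`; the registers of negative index are auxiliary storage. -/
@[ext] structure Config where
  label : ℕ
  i : ℕ
  j : ℕ
  reg : ℤ → ℝ

/-- The initial configuration on input `y`: copy-registers equal to `1`, the registers hold `y`,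
and all further registers are `0`. -/
def Config.init (y : List ℝ) : Config where
  label := 0
  i := 1
  j := 1
  reg := fun k =>
    if k = 0 then (y.length : ℝ) else if 0 < k then y.getD (k.toNat - 1) 0 else 0

/-- The finite sequence `x_1, …, x_n` with `n = x_0` that is held in the registers, provided that
`x_0` is a natural number. -/
def Config.word (c : Config) : Option (List ℝ) :=
  if c.reg 0 = (⌊c.reg 0⌋₊ : ℝ) then
    some (List.ofFn fun k : Fin ⌊c.reg 0⌋₊ => c.reg ((k : ℤ) + 1))
  else none

/-- The result of an arithmetic operation; division by zero has none. -/
def ArithOp.eval : ArithOp → ℝ → ℝ → Option ℝ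
  | .add, a, b => some (a + b)
  | .sub, a, b => some (a - b)
  | .mul, a, b => some (a * b)
  | .div, a, b => if b = 0 then none else some (a / b)

/-- The effect of an index operation on a copy-register. -/
def IndexOp.eval : IndexOp → ℕ → ℕ
  | .keep, n => n
  | .succ, n => n + 1
  | .zero, _ => 0

open Classical in
/-- Execution of one instruction with oracle `B`. It has no result (so that the computation never
reaches a halting configuration) at a division by zero and at a query for which register `0` does
not hold the size of a sequence. -/
def Instr.exec (B : Problem) : Instr → Config → Option Config
  | .arith o s k l u v, c =>
      (o.eval (c.reg k) (c.reg l)).map fun a =>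
        ⟨c.label + 1, u.eval c.i, v.eval c.j, Function.update c.reg s a⟩
  | .const s a u v, c =>
      some ⟨c.label + 1, u.eval c.i, v.eval c.j, Function.update c.reg s a⟩
  | .branch t, c =>
      some { c with label := if 0 ≤ c.reg 0 then t else c.label + 1 }
  | .copy, c =>
      some { c with label := c.label + 1, reg := Function.update c.reg c.i (c.reg c.j) }
  | .query t, c =>
      c.word.map fun y => { c with label := if y ∈ B then t else c.label + 1 }

/-- One step of the machine `p` with oracle `B`; there is none from a halting configuration. -/
def Program.step (B : Problem) (p : Program) (c : Config) : Option Config :=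
  p[c.label]?.bind fun I => I.exec B c

/-- With oracle `B` and on input `x`, the computation of `p` stops in the configuration `c`. -/
def Program.HaltsIn (B : Problem) (p : Program) (x : List ℝ) (c : Config) : Prop :=
  Relation.ReflTransGen (fun d e => p.step B d = some e) (Config.init x) c ∧ p.length ≤ c.label

/-- With oracle `B` and on input `x`, the computation of `p` terminates. -/
def Program.Halts (B : Problem) (p : Program) (x : List ℝ) : Prop :=
  ∃ c, p.HaltsIn B x c

/-- With oracle `B` and on input `x`, the computation of `p` terminates with output `y`. -/
def Program.Outputs (B : Problem) (p : Program) (x y : List ℝ) : Prop :=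
  ∃ c, p.HaltsIn B x c ∧ c.word = some y

/-- `A` is semi-decidable (recursively enumerable): some BSS machine (without oracle) halts
precisely on the elements of `A`. -/
def Semidecidable (A : Problem) : Prop :=
  ∃ p : Program, p.OracleFree ∧ ∀ x, p.Halts ∅ x ↔ x ∈ A

/-- `A ⪯ B`: some BSS oracle machine with oracle `B` computes the characteristic function
of `A`. -/
def Reducible (A B : Problem) : Prop :=
  ∃ p : Program, ∀ x, (x ∈ A → p.Outputs B x [1]) ∧ (x ∉ A → p.Outputs B x [0])

/-- `A ≡ B`: each of the two problems is reducible to the other. -/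
def Equivalent (A B : Problem) : Prop :=
  Reducible A B ∧ Reducible B A

/-- The (real) Turing degrees: the classes `{B | A ≡ B}`. -/
def Degree : Type :=
  {d : Set Problem // ∃ A : Problem, d = {B | Equivalent A B}}

/-- The degree of a problem. -/
def degree (A : Problem) : Degree :=
  ⟨{B | Equivalent A B}, A, rfl⟩

/-- The order of degrees is induced by reducibility of representatives. -/
instance : LE Degree :=
  ⟨fun d e => ∃ A ∈ d.1, ∃ B ∈ e.1, Reducible A B⟩

instance : LT Degree :=
  ⟨fun d e => d ≤ e ∧ ¬ e ≤ d⟩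

/-- A degree is recursively enumerable if it contains a semi-decidable problem. -/
def Degree.IsRE (d : Degree) : Prop :=
  ∃ A ∈ d.1, Semidecidable A

/-! ### The Halting Problem -/

def ArithOp.code : ArithOp → ℝ
  | .add => 1
  | .sub => 2
  | .mul => 3
  | .div => 4

def IndexOp.code : IndexOp → ℝ
  | .keep => 0
  | .succ => 1
  | .zero => 2

/-- The code of an instruction: always six reals, the first of which tells its type. -/
def Instr.code : Instr → List ℝ
  | .arith o s k l u v => [o.code, s, k, l, u.code, v.code]
  | .const s a u v => [5, s, a, 0, u.code, v.code]
  | .branch t => [6, t, 0, 0, 0, 0]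
  | .copy => [7, 0, 0, 0, 0, 0]
  | .query t => [8, t, 0, 0, 0, 0]

/-- The code of a machine: the number of its instructions, followed by their codes. -/
def Program.code (p : Program) : List ℝ :=
  (p.length : ℝ) :: p.flatMap Instr.code

/-- The real Halting Problem: given the code of a BSS machine (without oracle) together with an
input `x`, does the machine terminate on input `x`? -/
def haltingProblem : Problem :=
  {w | ∃ (p : Program) (x : List ℝ), w = p.code ++ x ∧ p.OracleFree ∧ p.Halts ∅ x}

/-! ### The fields of radicals -/

/-- The subfield `ℚ({p^(1/n) : p ∈ P, n ≥ 1})` of `ℝ`, for a set `P` of primes. -/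
def radicalField (P : Set Nat.Primes) : IntermediateField ℚ ℝ :=
  IntermediateField.adjoin ℚ
    {x : ℝ | ∃ p ∈ P, ∃ n : ℕ, 1 ≤ n ∧ x = ((p : ℕ) : ℝ) ^ ((1 : ℝ) / (n : ℝ))}

/-- This field as a decision problem: a set of sequences of size `1`. -/
def radicalProblem (P : Set Nat.Primes) : Problem :=
  {w | ∃ x ∈ radicalField P, w = [x]}

end BSS

end

noncomputable section

namespace BSS

/-! ### Degrees of real radicals -/

section Radicals

open Polynomial IntermediateField

/-! The positive reductions rest on countability. Every `F_Q` consists of algebraic reals, so its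
elements can be listed, and the digits of one real constant can store, for each listed `a`, integral
inequalities singling out `a` and one bit of advice. A machine with this constant searches the list
for its input (`exists_search`). Started on any real it halts exactly on `F_Q`; started only after
the oracle has confirmed membership in `F_Q` it always halts, and the advice bits then decide any
subset, in particular `F_P` for `P ⊆ Q`.

Conversely, run a reduction of `F_P` to `F_Q` at a point `ξ` transcendental over a field `K` that
contains the machine constants and all real algebraic numbers. Registers hold rational functions
over `K` of the input, and such a function vanishes near `ξ` once it vanishes at `ξ`. Hence the
branches agree for all inputs near `ξ`, and only the answers to finitely many queries can differ
(`run_generic`). Suppose `p ∈ P \ Q` and let `x` be a rational multiple of `p^(1/3^k)` near `ξ`. A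
locally constant query has the same answer at `x` and at `ξ`. A nonconstant query `f` has `f ξ ∉
F_Q`, and for large `k` only finitely many such `x` have `f x ∈ F_Q`
(`finite_radical_mem_radicalField`). So `x ∈ F_P` and `ξ ∉ F_P` are not told apart.

The finiteness is a matter of degrees. A rational function with infinitely many algebraic values at
algebraic points has algebraic coefficients, so the points it sends into `F_Q` have bounded degree
over `F_Q`, unless it is constant. But `p^(1/3^k)` has degree `3^k`, because `p` is not a cube in
`F_Q`; this follows from the vanishing of traces of irrational positive radicals.

What remains is to embed orders and antichains into the subsets of the primes under inclusion. -/

/-- The minimal polynomial of a positive real radical is binomial. -/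
theorem minpoly_eq_of_pow_eq_rat {h : ℝ} (h0 : 0 < h) {n : ℕ} (hn : n ≠ 0) {a : ℚ}
    (ha : h ^ n = a) : ∃ b : ℚ, minpoly ℚ h = X ^ (minpoly ℚ h).natDegree - C b := by
  have hroot : aeval h (X ^ n - C a : ℚ[X]) = 0 := by simp [ha]
  have hint : IsIntegral ℚ h := ⟨X ^ n - C a, monic_X_pow_sub_C a hn, by simpa using hroot⟩
  have hdvd := minpoly.dvd ℚ h hroot
  set m := minpoly ℚ h with hm
  have hmon : m.Monic := minpoly.monic hint
  set q : ℂ[X] := m.map (algebraMap ℚ ℂ) with hq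
  have hqm : q.Monic := hmon.map _
  have hs : q.Splits := IsAlgClosed.splits q
  have hprod := hs.coeff_zero_eq_prod_roots_of_monic hqm
  -- The minimal polynomial divides `X ^ n - a`, so its complex roots all have absolute value `h`.
  -- Its constant coefficient is then `± h ^ d` for its degree `d`, which makes `h ^ d` rational.
  have hroots : ∀ z ∈ q.roots, ‖z‖ = h := by
    intro z hz
    have hz0 : aeval z m = 0 := by
      have := (mem_roots hqm.ne_zero).1 hz
      rwa [IsRoot, hq, eval_map_algebraMap] at this
    have : aeval z (X ^ n - C a : ℚ[X]) = 0 := by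
      obtain ⟨r, hr⟩ := hdvd
      rw [hr, map_mul, hz0, zero_mul]
    have hzn : z ^ n = (a : ℂ) := by simpa [sub_eq_zero] using this
    have h2 : ‖z‖ ^ n = h ^ n := by
      rw [← norm_pow, hzn, ha]
      have : (0 : ℝ) ≤ a := by rw [← ha]; positivity
      rw [show ((a : ℚ) : ℂ) = ((a : ℝ) : ℂ) by simp, Complex.norm_real, Real.norm_of_nonneg this]
    exact (pow_left_inj₀ (norm_nonneg z) h0.le hn).1 h2
  have hcard : q.roots.card = m.natDegree := by
    rw [← hs.natDegree_eq_card_roots, hq, natDegree_map]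
  have hnorm : ‖q.coeff 0‖ = h ^ m.natDegree := by
    rw [hprod, norm_mul, norm_pow, norm_neg, norm_one, one_pow, one_mul]
    have : ∀ s : Multiset ℂ, (∀ z ∈ s, ‖z‖ = h) → ‖s.prod‖ = h ^ s.card := by
      intro s
      induction s using Multiset.induction_on with
      | empty => simp
      | cons z s ih =>
        intro hz
        rw [Multiset.prod_cons, norm_mul, hz z (by simp), ih fun w hw => hz w (by simp [hw]),
          Multiset.card_cons, pow_succ, mul_comm]
    rw [this _ hroots, hcard]
  have hb : h ^ m.natDegree = ((|m.coeff 0| : ℚ) : ℝ) := by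
    rw [← hnorm, hq, coeff_map]
    simp [Rat.cast_abs]
  refine ⟨|m.coeff 0|, ?_⟩
  have hd : m.natDegree ≠ 0 := (minpoly.natDegree_pos hint).ne'
  have hdvd2 : m ∣ X ^ m.natDegree - C |m.coeff 0| := minpoly.dvd ℚ h (by simp [hb])
  refine (eq_of_monic_of_dvd_of_natDegree_le hmon (monic_X_pow_sub_C _ hd) hdvd2 ?_).symm
  rw [natDegree_X_pow_sub_C]

/-- The minimal polynomial is binomial of degree at least two, so its second highest coefficient, of
which the trace is a multiple, vanishes. -/
theorem trace_eq_zero_of_pow_eq_rat (K : IntermediateField ℚ ℝ) [FiniteDimensional ℚ K] (h : K)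
    (h0 : 0 < (h : ℝ)) {n : ℕ} (hn : n ≠ 0) {a : ℚ} (ha : (h : ℝ) ^ n = a)
    (hirr : Irrational (h : ℝ)) : Algebra.trace ℚ K h = 0 := by
  obtain ⟨b, hb⟩ := minpoly_eq_of_pow_eq_rat h0 hn ha
  have hm : minpoly ℚ h = minpoly ℚ (h : ℝ) := IntermediateField.minpoly_eq h
  have hint : IsIntegral ℚ (h : ℝ) := by
    refine ⟨X ^ n - C a, monic_X_pow_sub_C a hn, ?_⟩
    simp [ha]
  have hd : 2 ≤ (minpoly ℚ (h : ℝ)).natDegree := by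
    rw [minpoly.two_le_natDegree_iff hint]
    rintro ⟨r, hr⟩
    exact hirr ⟨r, by simpa using hr⟩
  rw [trace_eq_finrank_mul_minpoly_nextCoeff, hm]
  rw [nextCoeff_of_natDegree_pos (by omega), hb, coeff_sub, coeff_X_pow, coeff_C,
    natDegree_X_pow_sub_C, if_neg (by omega), if_neg (by omega)]
  simp

/-- `1` is not a rational linear combination of irrational positive real radicals. -/
theorem one_notMem_span_radicals :
    (1 : ℝ) ∉ Submodule.span ℚ
      {h : ℝ | 0 < h ∧ Irrational h ∧ ∃ n : ℕ, n ≠ 0 ∧ ∃ a : ℚ, h ^ n = a} := by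
  intro hmem
  obtain ⟨T, hT, hmem⟩ := Submodule.mem_span_finite_of_mem_span hmem
  let K : IntermediateField ℚ ℝ := adjoin ℚ (T : Set ℝ)
  have hfin : FiniteDimensional ℚ K := by
    refine finiteDimensional_adjoin fun x hx => ?_
    obtain ⟨-, -, n, hn, a, ha⟩ := hT hx
    exact ⟨X ^ n - C a, monic_X_pow_sub_C a hn, by simp [ha]⟩
  -- The trace of a finite extension containing the radicals in use kills their span, while the
  -- trace of `1` is the degree of that extension.
  have key : ∀ x ∈ Submodule.span ℚ (T : Set ℝ), ∃ hx : x ∈ K, Algebra.trace ℚ K ⟨x, hx⟩ = 0 := by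
    intro x hx
    induction hx using Submodule.span_induction with
    | mem x hx =>
      obtain ⟨h0, hirr, n, hn, a, ha⟩ := hT hx
      exact ⟨subset_adjoin ℚ _ hx, trace_eq_zero_of_pow_eq_rat K ⟨x, _⟩ h0 hn ha hirr⟩
    | zero => exact ⟨K.zero_mem, map_zero _⟩
    | add x y _ _ hx hy =>
      obtain ⟨hx, hx'⟩ := hx
      obtain ⟨hy, hy'⟩ := hy
      refine ⟨K.add_mem hx hy, ?_⟩
      have : (⟨x + y, K.add_mem hx hy⟩ : K) = ⟨x, hx⟩ + ⟨y, hy⟩ := rfl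
      rw [this, map_add, hx', hy', add_zero]
    | smul r x _ hx =>
      obtain ⟨hx, hx'⟩ := hx
      refine ⟨K.smul_mem hx, ?_⟩
      have : (⟨r • x, K.smul_mem hx⟩ : K) = r • ⟨x, hx⟩ := rfl
      rw [this, map_smul, hx', smul_zero]
  obtain ⟨h1, h2⟩ := key 1 hmem
  have : Algebra.trace ℚ K (algebraMap ℚ K 1) = 0 := by
    rw [map_one]; exact h2
  rw [Algebra.trace_algebraMap] at this
  simp at this
  exact Module.finrank_pos.ne' this

/-! ### Radical fields and the degree of iterated cube roots -/

theorem rpow_one_div_pow {a : ℝ} (ha : 0 ≤ a) {n : ℕ} (hn : n ≠ 0) :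
    (a ^ ((1 : ℝ) / (n : ℝ))) ^ n = a := by
  rw [one_div, Real.rpow_inv_natCast_pow ha hn]

theorem isAlgebraic_of_pow_eq_rat {h : ℝ} {n : ℕ} (hn : n ≠ 0) {a : ℚ} (ha : h ^ n = a) :
    IsAlgebraic ℚ h :=
  ⟨X ^ n - C a, X_pow_sub_C_ne_zero (Nat.pos_of_ne_zero hn) a, by simp [ha]⟩

theorem isAlgebraic_radical (p : Nat.Primes) {n : ℕ} (hn : n ≠ 0) :
    IsAlgebraic ℚ (((p : ℕ) : ℝ) ^ ((1 : ℝ) / (n : ℝ))) :=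
  isAlgebraic_of_pow_eq_rat hn (a := (p : ℕ)) (by
    rw [rpow_one_div_pow (Nat.cast_nonneg _) hn]; simp)

theorem radicalField_le_algebraicClosure (P : Set Nat.Primes) :
    radicalField P ≤ algebraicClosure ℚ ℝ := by
  refine adjoin_le_iff.2 ?_
  rintro x ⟨p, -, n, hn, rfl⟩
  exact (isAlgebraic_radical p (by omega)).isIntegral

theorem radicalField_mono {P Q : Set Nat.Primes} (h : P ⊆ Q) : radicalField P ≤ radicalField Q := by
  refine adjoin.mono ℚ _ _ ?_
  rintro x ⟨p, hp, n, hn, rfl⟩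
  exact ⟨p, h hp, n, hn, rfl⟩

theorem radical_mem_radicalField {P : Set Nat.Primes} {p : Nat.Primes} (hp : p ∈ P) {n : ℕ}
    (hn : 1 ≤ n) : ((p : ℕ) : ℝ) ^ ((1 : ℝ) / (n : ℝ)) ∈ radicalField P :=
  subset_adjoin ℚ _ ⟨p, hp, n, hn, rfl⟩

/-- If `p ∉ Q` then `F_Q` is spanned by positive real radicals of integers prime to `p`. -/
theorem radicalField_le_span {Q : Set Nat.Primes} {p : Nat.Primes} (hp : p ∉ Q) {x : ℝ}
    (hx : x ∈ radicalField Q) :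
    x ∈ Submodule.span ℚ
      {g : ℝ | 0 < g ∧ ∃ n : ℕ, n ≠ 0 ∧ ∃ m : ℕ, ¬ (p : ℕ) ∣ m ∧ g ^ n = m} := by
  have hx' : x ∈ (radicalField Q).toSubalgebra := hx
  -- The generators are algebraic, so the field is already the algebra they generate, and is spanned
  -- by monomials in them.
  rw [radicalField, adjoin_toSubalgebra_of_isAlgebraic, ← Subalgebra.mem_toSubmodule,
    Algebra.adjoin_eq_span] at hx'
  · refine Submodule.span_mono ?_ hx'
    intro g hg
    induction hg using Submonoid.closure_induction with
    | mem g hg =>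
      obtain ⟨q, hq, n, hn, rfl⟩ := hg
      have hq0 : (0 : ℝ) < (q : ℕ) := by exact_mod_cast q.2.pos
      refine ⟨Real.rpow_pos_of_pos hq0 _, n, by omega, q, ?_, rpow_one_div_pow hq0.le (by omega)⟩
      intro hdvd
      have := (Nat.prime_dvd_prime_iff_eq p.2 q.2).1 hdvd
      exact hp (Subtype.ext this ▸ hq)
    | one => exact ⟨one_pos, 1, one_ne_zero, 1, p.2.one_lt.ne' ∘ Nat.dvd_one.1, by simp⟩
    | mul g h _ _ hg hh =>
      obtain ⟨hg0, n, hn, m, hm, hgn⟩ := hg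
      obtain ⟨hh0, n', hn', m', hm', hhn⟩ := hh
      refine ⟨mul_pos hg0 hh0, n * n', mul_ne_zero hn hn', m ^ n' * m' ^ n, ?_, ?_⟩
      · intro hd
        rcases (Nat.Prime.dvd_mul p.2).1 hd with hd | hd
        · exact hm (p.2.dvd_of_dvd_pow hd)
        · exact hm' (p.2.dvd_of_dvd_pow hd)
      · rw [mul_pow, pow_mul, hgn, mul_comm n n', pow_mul, hhn]
        push_cast; ring
  · rintro x ⟨p, -, n, hn, rfl⟩
    exact isAlgebraic_radical p (by omega)

/-- `p` is not a cube in `F_Q` if `p ∉ Q`. -/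
theorem pow_three_ne_of_mem_radicalField {Q : Set Nat.Primes} {p : Nat.Primes} (hp : p ∉ Q) {b : ℝ}
    (hb : b ∈ radicalField Q) : b ^ 3 ≠ (p : ℕ) := by
  intro hb3
  have hp0 : (0 : ℝ) < (p : ℕ) := by exact_mod_cast p.2.pos
  have hb0 : 0 < b := (Odd.pow_pos_iff (by decide : Odd 3)).1 (hb3 ▸ hp0)
  refine one_notMem_span_radicals ?_
  -- Dividing an expansion of `b` by `b` writes `1` as a combination of radicals `g / b`. It remains
  -- to see that each of them is irrational.
  have key := Submodule.mem_map_of_mem (f := LinearMap.mulRight ℚ b⁻¹) (radicalField_le_span hp hb)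
  rw [LinearMap.mulRight_apply, mul_inv_cancel₀ hb0.ne', Submodule.map_span] at key
  refine Submodule.span_mono ?_ key
  rintro _ ⟨g, ⟨hg0, n, hn, m, hm, hg⟩, rfl⟩
  have hpow : (g * b⁻¹) ^ (n * 3) = (m : ℝ) ^ 3 / (p : ℕ) ^ n := by
    rw [mul_pow, pow_mul, hg, mul_comm n 3, pow_mul, inv_pow b, hb3, inv_pow, div_eq_mul_inv]
  refine ⟨mul_pos hg0 (inv_pos.2 hb0), ?_, n * 3, by positivity, (m : ℚ) ^ 3 / (p : ℕ) ^ n, ?_⟩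
  · rintro ⟨r, hr⟩
    rw [LinearMap.mulRight_apply] at hr
    rw [← hr] at hpow
    have hpow' : r ^ (n * 3) * (p : ℕ) ^ n = (m : ℚ) ^ 3 := by
      have : (r : ℝ) ^ (n * 3) * (p : ℕ) ^ n = (m : ℝ) ^ 3 := by
        rw [hpow]; field_simp
      exact_mod_cast this
    have : Fact (p : ℕ).Prime := ⟨p.2⟩
    have hr0 : r ≠ 0 := by
      rintro rfl
      have : 0 < g * b⁻¹ := mul_pos hg0 (inv_pos.2 hb0)
      rw [← hr] at this
      simp at this
    have hpq : ((p : ℕ) : ℚ) ≠ 0 := by exact_mod_cast p.2.ne_zero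
    -- Comparing `p`-adic valuations gives `3 n v(r) + n = 0`, which is impossible for an integer
    -- `v(r)`.
    have h1 := congrArg (padicValRat p) hpow'
    rw [padicValRat.mul (pow_ne_zero _ hr0) (pow_ne_zero _ hpq), padicValRat.pow,
      padicValRat.pow, padicValRat.pow, padicValRat.self p.2.one_lt,
      padicValRat.of_nat, padicValNat.eq_zero_of_not_dvd hm] at h1
    push_cast at h1
    have h2 : (n : ℤ) * (3 * padicValRat p r + 1) = 0 := by linarith
    rcases mul_eq_zero.1 h2 with h | h <;> omega
  · rw [LinearMap.mulRight_apply, hpow]; push_cast; rfl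

/-- Iterated cube roots of `p` have full degree over `F_Q` if `p ∉ Q`. -/
theorem natDegree_minpoly_radical {Q : Set Nat.Primes} {p : Nat.Primes} (hp : p ∉ Q) (k : ℕ) :
    (minpoly (radicalField Q) (((p : ℕ) : ℝ) ^ ((1 : ℝ) / ((3 ^ k : ℕ) : ℝ)))).natDegree
      = 3 ^ k := by
  have hirr : Irreducible (X ^ 3 ^ k - C ((p : ℕ) : radicalField Q)) := by
    -- For powers of an odd prime, irreducibility only requires that the constant is not a cube;
    -- this is why cube roots are used.
    refine X_pow_sub_C_irreducible_of_prime_pow Nat.prime_three (by norm_num) k ?_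
    intro b hb
    refine pow_three_ne_of_mem_radicalField hp b.2 ?_
    have := congrArg (algebraMap (radicalField Q) ℝ) hb
    simpa using this
  rw [← minpoly.eq_of_irreducible_of_monic hirr _ (monic_X_pow_sub_C _ (by positivity)),
    natDegree_X_pow_sub_C]
  have := rpow_one_div_pow (a := ((p : ℕ) : ℝ)) (Nat.cast_nonneg _) (n := 3 ^ k) (by positivity)
  simp only [map_sub, map_pow, aeval_X, map_natCast]
  rw [this, sub_self]

/-! ### Rational functions at points of large degree -/

/-- A real rational function with algebraic values at infinitely many algebraic points has
algebraic coefficients. -/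
theorem exists_algebraic_of_infinite {F : IntermediateField ℚ ℝ} {A B : ℝ[X]} (hB : B ≠ 0)
    (hinf : {x : ℝ | x ∈ F ∧ ∃ y ∈ F, A.eval x = y * B.eval x}.Infinite) :
    ∃ A' B' : F[X], B' ≠ 0 ∧
      A * B'.map (algebraMap F ℝ) = A'.map (algebraMap F ℝ) * B := by
  -- An `F`-linear functional `φ : ℝ → F` applied to the coefficients commutes with evaluation at
  -- points of `F`, so it carries `A(x) = y B(x)` to the same relation between polynomials over `F`.
  -- Nonvanishing on the leading coefficient keeps the new denominator nonzero.
  have hex : ∃ φ : Module.Dual F ℝ, φ B.leadingCoeff ≠ 0 := by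
    by_contra! h
    exact leadingCoeff_ne_zero.2 hB ((Module.forall_dual_apply_eq_zero_iff F _).1 h)
  obtain ⟨φ, hφ⟩ := hex
  let T : ℝ[X] → F[X] := fun D => ∑ i ∈ Finset.range (D.natDegree + 1), C (φ (D.coeff i)) * X ^ i
  have hT : ∀ (D : ℝ[X]) (x : F), (T D).eval x = φ (D.eval (x : ℝ)) := by
    intro D x
    simp only [T, eval_finsetSum, eval_mul, eval_C, eval_pow, eval_X]
    rw [eval_eq_sum_range, map_sum]
    refine Finset.sum_congr rfl fun i _ => ?_
    have : D.coeff i * (x : ℝ) ^ i = (x ^ i : F) • D.coeff i := by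
      rw [mul_comm]; rfl
    rw [this, map_smul, smul_eq_mul, mul_comm]
  refine ⟨T A, T B, ?_, ?_⟩
  · intro h
    apply hφ
    have := congrArg (fun D => D.coeff B.natDegree) h
    simpa [T, finsetSum_coeff, coeff_C_mul, coeff_X_pow] using this
  · refine eq_of_infinite_eval_eq _ _ (hinf.mono ?_)
    rintro x ⟨hx, y, hy, hxy⟩
    have h1 : ∀ D : F[X], (D.map (algebraMap F ℝ)).eval x = ((D.eval ⟨x, hx⟩ : F) : ℝ) := by
      intro D
      rw [eval_map]
      exact eval₂_at_apply (algebraMap F ℝ) (⟨x, hx⟩ : F)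
    simp only [Set.mem_ofPred_eq, eval_mul, h1, hT, hxy]
    have : y * B.eval x = (⟨y, hy⟩ : F) • B.eval x := rfl
    rw [this, map_smul, Algebra.smul_def]
    simp only [smul_eq_mul, MulMemClass.coe_mul]
    change y * _ * _ = _
    ring

/-- By the tower law, `t` lies in `E(t)`, whose degree over `k` is the product on the right. -/
theorem natDegree_minpoly_le_mul (k : Type*) {E L : Type*} [Field k] [Field E] [Field L]
    [Algebra k E] [Algebra E L] [Algebra k L] [IsScalarTower k E L] [FiniteDimensional k E] {t : L}
    (ht : IsIntegral E t) :
    (minpoly k t).natDegree ≤ Module.finrank k E * (minpoly E t).natDegree := by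
  have := adjoin.finiteDimensional ht
  have : FiniteDimensional k E⟮t⟯ := FiniteDimensional.trans k E E⟮t⟯
  have : IsScalarTower k E⟮t⟯ L :=
    IsScalarTower.of_algebraMap_eq fun x => by
      rw [IsScalarTower.algebraMap_apply k E L x, IsScalarTower.algebraMap_apply k E E⟮t⟯ x]
      rfl
  have h1 : (minpoly k (AdjoinSimple.gen E t)).natDegree ≤ Module.finrank k E⟮t⟯ :=
    minpoly.natDegree_le _
  have h2 : minpoly k (AdjoinSimple.gen E t) = minpoly k t := by
    rw [← minpoly.algebraMap_eq (algebraMap E⟮t⟯ L).injective]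
    rfl
  rwa [h2, ← Module.finrank_mul_finrank k E E⟮t⟯, adjoin.finrank ht] at h1

/-- The roots of the polynomials `A - y B`, for `y` in the ground field, have bounded degree. -/
theorem exists_natDegree_minpoly_le (k : IntermediateField ℚ ℝ) (A B : ℝ[X])
    (hA : ∀ n, IsAlgebraic k (A.coeff n)) (hB : ∀ n, IsAlgebraic k (B.coeff n)) :
    ∃ m : ℕ, ∀ y ∈ k, ∀ t : ℝ, A - C y * B ≠ 0 → (A - C y * B).eval t = 0 →
      (minpoly k t).natDegree ≤ m := by
  let S : Finset ℝ := A.coeffs ∪ B.coeffs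
  let E : IntermediateField k ℝ := adjoin k (S : Set ℝ)
  have hfin : FiniteDimensional k E := by
    refine finiteDimensional_adjoin fun x hx => ?_
    rcases Finset.mem_union.1 (Finset.mem_coe.1 hx) with h | h
    · obtain ⟨n, -, rfl⟩ := mem_coeffs_iff.1 h
      exact (hA n).isIntegral
    · obtain ⟨n, -, rfl⟩ := mem_coeffs_iff.1 h
      exact (hB n).isIntegral
  have hlift : ∀ D : ℝ[X], D.coeffs ⊆ S → ∃ D' : E[X], D'.map (algebraMap E ℝ) = D := by
    intro D hD
    refine (mem_lifts D).1 ((lifts_iff_coeff_lifts D).2 fun n => ?_)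
    by_cases hn : D.coeff n = 0
    · exact ⟨0, by rw [hn, map_zero]⟩
    · exact ⟨⟨D.coeff n, subset_adjoin k _ (hD (coeff_mem_coeffs hn))⟩, rfl⟩
  obtain ⟨A', hA'⟩ := hlift A Finset.subset_union_left
  obtain ⟨B', hB'⟩ := hlift B Finset.subset_union_right
  refine ⟨Module.finrank k E * (max A.natDegree B.natDegree), fun y hy t hne hroot => ?_⟩
  let D : E[X] := A' - C (algebraMap k E ⟨y, hy⟩) * B'
  have hD : D.map (algebraMap E ℝ) = A - C y * B := by
    simp only [D, Polynomial.map_sub, Polynomial.map_mul, map_C, hA', hB']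
    rfl
  have hD0 : D ≠ 0 := by
    intro h
    rw [h, Polynomial.map_zero] at hD
    exact hne hD.symm
  have hDt : aeval t D = 0 := by
    rw [← eval_map_algebraMap, hD, hroot]
  have hint : IsIntegral E t := IsAlgebraic.isIntegral ⟨D, hD0, hDt⟩
  have hdeg : (minpoly E t).natDegree ≤ max A.natDegree B.natDegree := by
    refine (natDegree_le_natDegree (minpoly.degree_le_of_ne_zero E t hD0 hDt)).trans ?_
    rw [← natDegree_map (algebraMap E ℝ), hD]
    refine (natDegree_sub_le _ _).trans (max_le_max le_rfl ?_)
    exact natDegree_C_mul_le _ _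
  exact (natDegree_minpoly_le_mul k hint).trans (Nat.mul_le_mul_left _ hdeg)

/-- A nonconstant real rational function maps only finitely many rational multiples of an iterated
cube root of `p` of high order into `F_Q`, if `p ∉ Q`. -/
theorem finite_radical_mem_radicalField {Q : Set Nat.Primes} {p : Nat.Primes} (hp : p ∉ Q)
    {A B : ℝ[X]} (hAB : ∀ y : ℝ, A ≠ C y * B) :
    ∃ k₀ : ℕ, ∀ k ≥ k₀, {x : ℝ | (∃ r : ℚ, x = r * ((p : ℕ) : ℝ) ^ ((1 : ℝ) / ((3 ^ k : ℕ) : ℝ))) ∧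
      B.eval x ≠ 0 ∧ ∃ y ∈ radicalField Q, A.eval x = y * B.eval x}.Finite := by
  let F := algebraicClosure ℚ ℝ
  by_cases hinf : {x : ℝ | x ∈ F ∧ ∃ y ∈ F, A.eval x = y * B.eval x}.Finite
  · refine ⟨0, fun k _ => hinf.subset ?_⟩
    rintro x ⟨⟨r, rfl⟩, -, y, hy, hxy⟩
    refine ⟨F.mul_mem (by simp) ?_, y,
      radicalField_le_algebraicClosure Q hy, hxy⟩
    exact (isAlgebraic_radical p (by positivity)).isIntegral
  by_cases hB0 : B = 0
  · refine ⟨0, fun k _ => ?_⟩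
    simp [hB0]
  obtain ⟨A', B', hB', hmul⟩ := exists_algebraic_of_infinite hB0 hinf
  have hB1 : B'.map (algebraMap F ℝ) ≠ 0 := (Polynomial.map_ne_zero_iff (algebraMap F ℝ).injective).2 hB'
  have halg : ∀ (D : F[X]) n, IsAlgebraic (radicalField Q) ((D.map (algebraMap F ℝ)).coeff n) := by
    intro D n
    rw [coeff_map]
    have : IsAlgebraic ℚ (algebraMap F ℝ (D.coeff n)) :=
      (mem_algebraicClosure_iff.1 (D.coeff n).2)
    exact this.tower_top (radicalField Q)
  set A₁ := A'.map (algebraMap F ℝ)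
  set B₁ := B'.map (algebraMap F ℝ)
  obtain ⟨m, hm⟩ := exists_natDegree_minpoly_le (radicalField Q) A₁ B₁ (halg A') (halg B')
  -- The coefficients may now be taken algebraic. A nonzero `x` in the set would have degree at most
  -- `m` but also degree `3 ^ k > m`, so only `0` can occur.
  refine ⟨m + 1, fun k hk => (Set.finite_singleton (0 : ℝ)).subset ?_⟩
  rintro x ⟨⟨r, hr⟩, hBx, y, hy, hxy⟩
  by_contra hx0
  set t : ℝ := ((p : ℕ) : ℝ) ^ ((1 : ℝ) / ((3 ^ k : ℕ) : ℝ))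
  have hr0 : r ≠ 0 := by
    rintro rfl
    exact hx0 (by simpa using hr)
  have hne : A₁ - C y * B₁ ≠ 0 := by
    intro h
    rw [sub_eq_zero] at h
    rw [h] at hmul
    refine hAB y (mul_right_cancel₀ hB1 ?_)
    rw [hmul]; ring
  have hroot : (A₁ - C y * B₁).eval x = 0 := by
    have := congrArg (eval x) hmul
    rw [eval_mul, eval_mul, hxy] at this
    rw [eval_sub, eval_mul, eval_C]
    refine mul_right_cancel₀ hBx ?_
    linear_combination -this
  have h1 := hm y hy x hne hroot
  have h2 : (minpoly (radicalField Q) x).natDegree = (minpoly (radicalField Q) t).natDegree := by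
    have hmem : ∀ a b : ℝ, ∀ s : ℚ, a = s * b → a ∈ (radicalField Q)⟮b⟯ := by
      intro a b s h
      rw [h]
      refine mul_mem ?_ (mem_adjoin_simple_self _ b)
      simp
    have heq : (radicalField Q)⟮x⟯ = (radicalField Q)⟮t⟯ := by
      apply le_antisymm
      · exact adjoin_simple_le_iff.2 (hmem x t r hr)
      · refine adjoin_simple_le_iff.2 (hmem t x r⁻¹ ?_)
        have : (r : ℝ) ≠ 0 := by exact_mod_cast hr0
        rw [hr]; push_cast; field_simp
    have ht : IsIntegral (radicalField Q) t :=
      ((isAlgebraic_radical p (by positivity)).tower_top _).isIntegral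
    have hx : IsIntegral (radicalField Q) x := by
      have : IsIntegral (radicalField Q) ((r : radicalField Q) • t) := ht.smul _
      rw [hr]
      exact this
    rw [← adjoin.finrank hx, ← adjoin.finrank ht, heq]
  rw [h2, natDegree_minpoly_radical hp] at h1
  have := Nat.lt_pow_self (n := k) (a := 3) (by norm_num)
  omega

end Radicals

/-! ### Computations near a generic point -/

section Generic

open Polynomial Filter Topology

/-- `f` is given near `ξ` by a rational function with coefficients in `K`. -/
def IsRationalAt (K : Subfield ℝ) (ξ : ℝ) (f : ℝ → ℝ) : Prop :=
  ∃ A B : K[X], B ≠ 0 ∧ ∀ᶠ x in 𝓝 ξ, f x = aeval x A / aeval x B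

variable {K : Subfield ℝ} {ξ : ℝ}

theorem eventually_aeval_ne_zero (hξ : Transcendental K ξ) {B : K[X]} (hB : B ≠ 0) :
    ∀ᶠ x in 𝓝 ξ, aeval x B ≠ 0 :=
  (Polynomial.continuous_aeval B).continuousAt.eventually_ne fun h =>
    hB ((transcendental_iff.1 hξ) B h)

namespace IsRationalAt

theorem const {a : ℝ} (ha : a ∈ K) : IsRationalAt K ξ fun _ => a :=
  ⟨C ⟨a, ha⟩, 1, one_ne_zero, .of_forall fun x => by simp; rfl⟩

theorem id : IsRationalAt K ξ fun x => x :=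
  ⟨X, 1, one_ne_zero, .of_forall fun x => by simp⟩

theorem add (hξ : Transcendental K ξ) {f g : ℝ → ℝ} (hf : IsRationalAt K ξ f)
    (hg : IsRationalAt K ξ g) : IsRationalAt K ξ fun x => f x + g x := by
  obtain ⟨A, B, hB, hf⟩ := hf
  obtain ⟨C, D, hD, hg⟩ := hg
  refine ⟨A * D + B * C, B * D, mul_ne_zero hB hD, ?_⟩
  filter_upwards [hf, hg, eventually_aeval_ne_zero hξ hB, eventually_aeval_ne_zero hξ hD]
    with x h1 h2 h3 h4
  rw [h1, h2, div_add_div _ _ h3 h4]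
  simp

theorem mul {f g : ℝ → ℝ} (hf : IsRationalAt K ξ f)
    (hg : IsRationalAt K ξ g) : IsRationalAt K ξ fun x => f x * g x := by
  obtain ⟨A, B, hB, hf⟩ := hf
  obtain ⟨C, D, hD, hg⟩ := hg
  refine ⟨A * C, B * D, mul_ne_zero hB hD, ?_⟩
  filter_upwards [hf, hg] with x h1 h2
  rw [h1, h2, div_mul_div_comm]
  simp

theorem sub (hξ : Transcendental K ξ) {f g : ℝ → ℝ} (hf : IsRationalAt K ξ f)
    (hg : IsRationalAt K ξ g) : IsRationalAt K ξ fun x => f x - g x := by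
  have := hf.add hξ ((const (K.neg_mem K.one_mem)).mul hg)
  simpa [sub_eq_add_neg] using this

theorem div {f g : ℝ → ℝ} (hf : IsRationalAt K ξ f)
    (hg : IsRationalAt K ξ g) (h0 : g ξ ≠ 0) : IsRationalAt K ξ fun x => f x / g x := by
  obtain ⟨A, B, hB, hf⟩ := hf
  obtain ⟨C, D, hD, hg⟩ := hg
  have hC : C ≠ 0 := by
    rintro rfl
    exact h0 (by simpa using hg.self_of_nhds)
  refine ⟨A * D, B * C, mul_ne_zero hB hC, ?_⟩
  filter_upwards [hf, hg] with x h1 h2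
  rw [h1, h2, div_div_div_eq]
  simp

theorem continuousAt (hξ : Transcendental K ξ) {f : ℝ → ℝ} (hf : IsRationalAt K ξ f) :
    ContinuousAt f ξ := by
  obtain ⟨A, B, hB, hf⟩ := hf
  refine ContinuousAt.congr ?_ (EventuallyEq.symm hf)
  exact (Polynomial.continuous_aeval A).continuousAt.div (Polynomial.continuous_aeval B).continuousAt
    (eventually_aeval_ne_zero hξ hB).self_of_nhds

/-- A numerator over `K` that vanishes at a point transcendental over `K` is the zero polynomial.
This covers the case that continuity leaves open in sign tests. -/
theorem eventually_eq_zero (hξ : Transcendental K ξ) {f : ℝ → ℝ} (hf : IsRationalAt K ξ f)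
    (h0 : f ξ = 0) : ∀ᶠ x in 𝓝 ξ, f x = 0 := by
  obtain ⟨A, B, hB, hf⟩ := hf
  have h1 := hf.self_of_nhds
  rw [h0, eq_comm, div_eq_zero_iff,
    or_iff_left (eventually_aeval_ne_zero hξ hB).self_of_nhds] at h1
  have hA : A = 0 := (transcendental_iff.1 hξ) A h1
  filter_upwards [hf] with x hx
  simp [hx, hA]

theorem eventually_eq_const (hξ : Transcendental K ξ) {f : ℝ → ℝ} (hf : IsRationalAt K ξ f)
    {a : ℝ} (ha : a ∈ K) (h0 : f ξ = a) : ∀ᶠ x in 𝓝 ξ, f x = a := by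
  filter_upwards [(hf.sub hξ (const ha)).eventually_eq_zero hξ (by simp [h0])] with x hx
  exact sub_eq_zero.1 hx

theorem eventually_nonneg_iff (hξ : Transcendental K ξ) {f : ℝ → ℝ} (hf : IsRationalAt K ξ f) :
    ∀ᶠ x in 𝓝 ξ, (0 ≤ f x ↔ 0 ≤ f ξ) := by
  rcases lt_trichotomy (f ξ) 0 with h | h | h
  · filter_upwards [(hf.continuousAt hξ).eventually_lt continuousAt_const h] with x hx
    exact iff_of_false hx.not_ge h.not_ge
  · filter_upwards [hf.eventually_eq_zero hξ h] with x hx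
    rw [hx, h]
  · filter_upwards [continuousAt_const.eventually_lt (hf.continuousAt hξ) h] with x hx
    exact iff_of_true hx.le h.le

end IsRationalAt

/-! ### Machine runs near a generic point -/

/-- At the points of a curve of words, and near its generic point, membership of `A` is
determined by membership of `B` of finitely many words of rational functions. -/
def GenericallyReducible (K : Subfield ℝ) (ξ : ℝ) (A B : Problem) : Prop :=
  ∀ γ : List (ℝ → ℝ), (∀ f ∈ γ, IsRationalAt K ξ f) →
    ∃ Δ : List (List (ℝ → ℝ)), (∀ δ ∈ Δ, ∀ f ∈ δ, IsRationalAt K ξ f) ∧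
      ∀ᶠ x in 𝓝 ξ, (∀ δ ∈ Δ, (δ.map (· x) ∈ B ↔ δ.map (· ξ) ∈ B)) →
        (γ.map (· x) ∈ A ↔ γ.map (· ξ) ∈ A)

/-- Each of the finitely many queries to `B` is replaced by its queries to `C`. This takes the place
of composing oracle machines. -/
theorem GenericallyReducible.trans {A B C : Problem} (hAB : GenericallyReducible K ξ A B)
    (hBC : GenericallyReducible K ξ B C) : GenericallyReducible K ξ A C := by
  intro γ hγ
  obtain ⟨Δ, hΔ, h⟩ := hAB γ hγ
  have key : ∀ Δ : List (List (ℝ → ℝ)), (∀ δ ∈ Δ, ∀ f ∈ δ, IsRationalAt K ξ f) →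
      ∃ Θ : List (List (ℝ → ℝ)), (∀ δ ∈ Θ, ∀ f ∈ δ, IsRationalAt K ξ f) ∧
        ∀ᶠ x in 𝓝 ξ, (∀ δ ∈ Θ, (δ.map (· x) ∈ C ↔ δ.map (· ξ) ∈ C)) →
          ∀ δ ∈ Δ, (δ.map (· x) ∈ B ↔ δ.map (· ξ) ∈ B) := by
    intro Δ
    induction Δ with
    | nil => exact fun _ => ⟨[], by simp, by simp⟩
    | cons δ Δ ih =>
      intro hΔ
      rw [List.forall_mem_cons] at hΔ
      obtain ⟨Θ, hΘ, h⟩ := ih hΔ.2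
      obtain ⟨Θ', hΘ', h'⟩ := hBC δ hΔ.1
      refine ⟨Θ' ++ Θ, List.forall_mem_append.2 ⟨hΘ', hΘ⟩, ?_⟩
      filter_upwards [h, h'] with x hx hx' hall
      rw [List.forall_mem_append] at hall
      exact List.forall_mem_cons.2 ⟨hx' hall.1, hx hall.2⟩
  obtain ⟨Θ, hΘ, h'⟩ := key Δ hΔ
  refine ⟨Θ, hΘ, ?_⟩
  filter_upwards [h, h'] with x hx hx' hall
  exact hx (hx' hall)

/-- The configuration at `x` of a family of configurations with constant control. -/
def Config.at (c : Config) (ρ : ℤ → ℝ → ℝ) (x : ℝ) : Config :=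
  ⟨c.label, c.i, c.j, fun z => ρ z x⟩

theorem isRationalAt_update {ρ : ℤ → ℝ → ℝ} (hρ : ∀ z, IsRationalAt K ξ (ρ z)) (s : ℤ)
    {f : ℝ → ℝ} (hf : IsRationalAt K ξ f) (z : ℤ) :
    IsRationalAt K ξ (Function.update ρ s f z) := by
  by_cases h : z = s
  · subst h; simpa using hf
  · simpa [h] using hρ z

theorem update_eval (ρ : ℤ → ℝ → ℝ) (s : ℤ) (f : ℝ → ℝ) (x : ℝ) :
    (fun z => Function.update ρ s f z x) = Function.update (fun z => ρ z x) s (f x) := by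
  funext z
  by_cases h : z = s
  · subst h; simp
  · simp [h]

/-- Signs and nonzero divisors persist near `ξ`, so an instruction acts in the same way there, on
registers that stay rational functions. A query contributes its word to `Δ`, and the step is uniform
wherever the answer is the one given at `ξ`. -/
theorem exec_generic (hξ : Transcendental K ξ) (B : Problem) (I : Instr)
    (hI : ∀ s a u v, I = .const s a u v → a ∈ K) (c d : Config) (ρ : ℤ → ℝ → ℝ)
    (hρ : ∀ z, IsRationalAt K ξ (ρ z)) (hc : ∀ z, ρ z ξ = c.reg z) (hcd : I.exec B c = some d) :
    ∃ ρ' : ℤ → ℝ → ℝ, (∀ z, IsRationalAt K ξ (ρ' z)) ∧ (∀ z, ρ' z ξ = d.reg z) ∧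
      ∃ Δ : List (List (ℝ → ℝ)), (∀ δ ∈ Δ, ∀ f ∈ δ, IsRationalAt K ξ f) ∧
        ∀ᶠ x in 𝓝 ξ, (∀ δ ∈ Δ, (δ.map (· x) ∈ B ↔ δ.map (· ξ) ∈ B)) →
          I.exec B (c.at ρ x) = some (d.at ρ' x) := by
  cases I with
  | arith o s k l u v =>
    have key : ∃ f : ℝ → ℝ, IsRationalAt K ξ f ∧ o.eval (c.reg k) (c.reg l) = some (f ξ) ∧
        ∀ᶠ x in 𝓝 ξ, o.eval (ρ k x) (ρ l x) = some (f x) := by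
      cases o with
      | add => exact ⟨_, (hρ k).add hξ (hρ l), by simp [ArithOp.eval, hc],
          .of_forall fun x => rfl⟩
      | sub => exact ⟨_, (hρ k).sub hξ (hρ l), by simp [ArithOp.eval, hc],
          .of_forall fun x => rfl⟩
      | mul => exact ⟨_, (hρ k).mul (hρ l), by simp [ArithOp.eval, hc],
          .of_forall fun x => rfl⟩
      | div =>
        have h0 : c.reg l ≠ 0 := by
          intro h0
          simp [Instr.exec, ArithOp.eval, h0] at hcd
        rw [← hc] at h0
        refine ⟨_, (hρ k).div (hρ l) h0, by simp [ArithOp.eval, ← hc, h0], ?_⟩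
        filter_upwards [((hρ l).continuousAt hξ).eventually_ne h0] with x hx
        simp [ArithOp.eval, hx]
    obtain ⟨f, hf, hfξ, hfx⟩ := key
    simp only [Instr.exec, hfξ, Option.map_some, Option.some.injEq] at hcd
    subst hcd
    refine ⟨Function.update ρ s f, isRationalAt_update hρ s hf, fun z => ?_, [], by simp, ?_⟩
    · rw [show Function.update ρ s f z ξ = (fun z => Function.update ρ s f z ξ) z from rfl,
        update_eval]
      simp only [hc]
    · filter_upwards [hfx] with x hx _
      simp only [Instr.exec, Config.at, hx, Option.map_some, update_eval]
  | const s a u v =>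
    simp only [Instr.exec, Option.some.injEq] at hcd
    subst hcd
    refine ⟨Function.update ρ s fun _ => a, isRationalAt_update hρ s (.const (hI s a u v rfl)),
      fun z => ?_, [], by simp, ?_⟩
    · rw [show Function.update ρ s (fun _ => a) z ξ =
        (fun z => Function.update ρ s (fun _ => a) z ξ) z from rfl, update_eval]
      simp only [hc]
    · refine .of_forall fun x _ => ?_
      simp only [Instr.exec, Config.at, update_eval]
  | branch t =>
    simp only [Instr.exec, Option.some.injEq] at hcd
    subst hcd
    refine ⟨ρ, hρ, hc, [], by simp, ?_⟩
    filter_upwards [(hρ 0).eventually_nonneg_iff hξ] with x hx _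
    simp only [Instr.exec, Config.at, hx, hc]
  | copy =>
    simp only [Instr.exec, Option.some.injEq] at hcd
    subst hcd
    refine ⟨Function.update ρ c.i (ρ c.j), isRationalAt_update hρ _ (hρ _), fun z => ?_, [],
      by simp, ?_⟩
    · rw [show Function.update ρ (c.i : ℤ) (ρ c.j) z ξ =
        (fun z => Function.update ρ (c.i : ℤ) (ρ c.j) z ξ) z from rfl, update_eval]
      simp only [hc]
    · refine .of_forall fun x _ => ?_
      simp only [Instr.exec, Config.at, update_eval]
  | query t =>
    simp only [Instr.exec, Option.map_eq_some_iff] at hcd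
    obtain ⟨y, hy, rfl⟩ := hcd
    simp only [Config.word, Option.ite_none_right_eq_some, Option.some.injEq] at hy
    obtain ⟨h0, rfl⟩ := hy
    set n := ⌊c.reg 0⌋₊
    -- The size register has a natural number as its value at `ξ`, so it is locally constant and the
    -- queried word keeps its length.
    have hn : ∀ᶠ x in 𝓝 ξ, ρ 0 x = n :=
      (hρ 0).eventually_eq_const hξ (natCast_mem K n) ((hc 0).trans h0)
    refine ⟨ρ, hρ, hc, [List.ofFn fun k : Fin n => ρ ((k : ℤ) + 1)], ?_, ?_⟩
    · intro δ hδ f hf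
      rw [List.mem_singleton] at hδ
      subst hδ
      obtain ⟨k, rfl⟩ := List.mem_ofFn.1 hf
      exact hρ _
    · filter_upwards [hn] with x hx hall
      have h1 := hall _ (List.mem_singleton_self _)
      simp only [List.map_ofFn, Function.comp_def, hc] at h1
      have h2 : (c.at ρ x).word = some (List.ofFn fun k : Fin n => ρ ((k : ℤ) + 1) x) := by
        simp only [Config.word, Config.at, hx, Nat.floor_natCast, if_true]
        rfl
      simp only [Instr.exec, h2, Option.map_some]
      refine congrArg some ?_
      ext1
      · by_cases hm : (List.ofFn fun k : Fin n => c.reg ((k : ℤ) + 1)) ∈ B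
        · exact (if_pos (h1.2 hm)).trans (if_pos hm).symm
        · exact (if_neg (mt h1.1 hm)).trans (if_neg hm).symm
      all_goals rfl

/-- The constants of a machine. -/
def Program.constants (p : Program) : Set ℝ :=
  {a | ∃ s u v, Instr.const s a u v ∈ p}

theorem run_generic (hξ : Transcendental K ξ) (B : Problem) (p : Program)
    (hp : p.constants ⊆ K) (c d : Config) (ρ : ℤ → ℝ → ℝ)
    (hρ : ∀ z, IsRationalAt K ξ (ρ z)) (hc : ∀ z, ρ z ξ = c.reg z)
    (hcd : Relation.ReflTransGen (fun d e => p.step B d = some e) c d) :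
    ∃ ρ' : ℤ → ℝ → ℝ, (∀ z, IsRationalAt K ξ (ρ' z)) ∧ (∀ z, ρ' z ξ = d.reg z) ∧
      ∃ Δ : List (List (ℝ → ℝ)), (∀ δ ∈ Δ, ∀ f ∈ δ, IsRationalAt K ξ f) ∧
        ∀ᶠ x in 𝓝 ξ, (∀ δ ∈ Δ, (δ.map (· x) ∈ B ↔ δ.map (· ξ) ∈ B)) →
          Relation.ReflTransGen (fun d e => p.step B d = some e) (c.at ρ x) (d.at ρ' x) := by
  induction hcd with
  | refl => exact ⟨ρ, hρ, hc, [], by simp, .of_forall fun x _ => .refl⟩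
  | tail _ hde ih =>
    obtain ⟨ρ', hρ', hc', Δ, hΔ, h⟩ := ih
    obtain ⟨I, hI, hIe⟩ := Option.bind_eq_some_iff.1 hde
    obtain ⟨ρ'', hρ'', hc'', Θ, hΘ, h'⟩ := exec_generic hξ B I
      (fun s a u v h => hp ⟨s, u, v, h ▸ List.mem_of_getElem? hI⟩) _ _ ρ' hρ' hc' hIe
    refine ⟨ρ'', hρ'', hc'', Δ ++ Θ, List.forall_mem_append.2 ⟨hΔ, hΘ⟩, ?_⟩
    filter_upwards [h, h'] with x hx hx' hall
    rw [List.forall_mem_append] at hall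
    refine (hx hall.1).tail ?_
    exact Option.bind_eq_some_iff.2 ⟨I, hI, hx' hall.2⟩

theorem step_eq_none (B : Problem) {p : Program} {c : Config} (h : p.length ≤ c.label) :
    p.step B c = none := by
  simp [Program.step, List.getElem?_eq_none h]

/-- The machine is deterministic and cannot move on from a stopped configuration. -/
theorem haltsIn_unique {B : Problem} {p : Program} {x : List ℝ} {c d : Config}
    (hc : p.HaltsIn B x c) (hd : p.HaltsIn B x d) : c = d := by
  have hu : Relator.RightUnique (fun d e => p.step B d = some e) := fun a b c h1 h2 =>
    Option.some.inj (h1.symm.trans h2)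
  have key : ∀ {c d : Config}, p.length ≤ c.label →
      Relation.ReflTransGen (fun d e => p.step B d = some e) c d → c = d := by
    intro c d hl h
    rcases h.cases_head with h | ⟨e, h, -⟩
    · exact h
    · rw [step_eq_none B hl] at h; cases h
  rcases Relation.ReflTransGen.total_of_right_unique hu hc.1 hd.1 with h | h
  · exact key hc.2 h
  · exact (key hd.2 h).symm

theorem outputs_unique {B : Problem} {p : Program} {x y z : List ℝ}
    (hy : p.Outputs B x y) (hz : p.Outputs B x z) : y = z := by
  obtain ⟨c, hc, hy⟩ := hy
  obtain ⟨d, hd, hz⟩ := hz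
  rw [haltsIn_unique hc hd, hz] at hy
  exact (Option.some.inj hy).symm

theorem word_eq_singleton {c : Config} {a : ℝ} :
    c.word = some [a] ↔ c.reg 0 = 1 ∧ c.reg 1 = a := by
  unfold Config.word
  constructor
  · intro h
    rw [Option.ite_none_right_eq_some] at h
    obtain ⟨h0, h⟩ := h
    have hl := congrArg List.length (Option.some.inj h)
    rw [List.length_ofFn, List.length_singleton] at hl
    rw [hl] at h0 h
    exact ⟨by simpa using h0, by simpa using h⟩
  · rintro ⟨h0, h1⟩
    rw [h0]
    simp [h1]

theorem Program.outputs_generic (hξ : Transcendental K ξ) (B : Problem) (p : Program)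
    (hp : p.constants ⊆ K) (γ : List (ℝ → ℝ)) (hγ : ∀ f ∈ γ, IsRationalAt K ξ f) {a : ℝ}
    (ha : a ∈ K) (h : p.Outputs B (γ.map (· ξ)) [a]) :
    ∃ Δ : List (List (ℝ → ℝ)), (∀ δ ∈ Δ, ∀ f ∈ δ, IsRationalAt K ξ f) ∧
      ∀ᶠ x in 𝓝 ξ, (∀ δ ∈ Δ, (δ.map (· x) ∈ B ↔ δ.map (· ξ) ∈ B)) →
        p.Outputs B (γ.map (· x)) [a] := by
  obtain ⟨d, ⟨hd, hl⟩, hw⟩ := h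
  let ρ : ℤ → ℝ → ℝ := fun k =>
    if k = 0 then fun _ => (γ.length : ℝ)
    else if 0 < k then γ.getD (k.toNat - 1) (fun _ => 0) else fun _ => 0
  have hinit : ∀ x, (Config.init (γ.map (· ξ))).at ρ x = Config.init (γ.map (· x)) := by
    intro x
    ext1
    · rfl
    · rfl
    · rfl
    · funext k
      simp only [Config.at, ρ, Config.init, List.length_map]
      split_ifs
      · rfl
      · simp only [List.getD_eq_getElem?_getD, List.getElem?_map]
        cases γ[k.toNat - 1]? <;> rfl
      · rfl
  have hρ : ∀ z, IsRationalAt K ξ (ρ z) := by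
    intro z
    simp only [ρ]
    split_ifs
    · exact .const (natCast_mem K _)
    · rw [List.getD_eq_getElem?_getD]
      cases hz : γ[z.toNat - 1]? with
      | none => exact .const K.zero_mem
      | some f => exact hγ f (List.mem_of_getElem? hz)
    · exact .const K.zero_mem
  have hc : ∀ z, ρ z ξ = (Config.init (γ.map (· ξ))).reg z := fun z =>
    congrFun (congrArg Config.reg (hinit ξ)) z
  obtain ⟨ρ', hρ', hc', Δ, hΔ, h⟩ := run_generic hξ B p hp _ d ρ hρ hc hd
  refine ⟨Δ, hΔ, ?_⟩
  rw [word_eq_singleton] at hw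
  filter_upwards [h, (hρ' 0).eventually_eq_const hξ K.one_mem ((hc' 0).trans hw.1),
    (hρ' 1).eventually_eq_const hξ ha ((hc' 1).trans hw.2)] with x hx h0 h1 hall
  refine ⟨d.at ρ' x, ⟨hinit x ▸ hx hall, hl⟩, word_eq_singleton.2 ⟨h0, h1⟩⟩

/-- Equal oracle answers give equal outputs near `ξ`, and the output determines membership because
it is unique. -/
theorem genericallyReducible_of_program (hξ : Transcendental K ξ) {A B : Problem} {p : Program}
    (hp : p.constants ⊆ K)
    (h : ∀ x, (x ∈ A → p.Outputs B x [1]) ∧ (x ∉ A → p.Outputs B x [0])) :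
    GenericallyReducible K ξ A B := by
  intro γ hγ
  by_cases hA : γ.map (· ξ) ∈ A
  · obtain ⟨Δ, hΔ, h'⟩ := p.outputs_generic hξ B hp γ hγ K.one_mem ((h _).1 hA)
    refine ⟨Δ, hΔ, ?_⟩
    filter_upwards [h'] with x hx hall
    refine iff_of_true ?_ hA
    by_contra hnA
    simpa using outputs_unique (hx hall) ((h _).2 hnA)
  · obtain ⟨Δ, hΔ, h'⟩ := p.outputs_generic hξ B hp γ hγ K.zero_mem ((h _).2 hA)
    refine ⟨Δ, hΔ, ?_⟩
    filter_upwards [h'] with x hx hall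
    refine iff_of_false ?_ hA
    intro hxA
    simpa using outputs_unique (hx hall) ((h _).1 hxA)

theorem Program.countable_constants (p : Program) : p.constants.Countable := by
  refine Set.Countable.mono ?_ ((List.finite_toSet
    (p.map fun I => match I with | .const _ a _ _ => a | _ => 0)).countable)
  rintro a ⟨s, u, v, h⟩
  exact List.mem_map.2 ⟨_, h, rfl⟩

/-- A reduction is a generic reduction, over every field that contains a certain countable set. -/
theorem Reducible.generically {A B : Problem} (h : Reducible A B) :
    ∃ S : Set ℝ, S.Countable ∧ ∀ (K : Subfield ℝ) (ξ : ℝ), S ⊆ K → Transcendental K ξ →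
      GenericallyReducible K ξ A B := by
  obtain ⟨p, hp⟩ := h
  exact ⟨p.constants, p.countable_constants, fun K ξ hK hξ =>
    genericallyReducible_of_program hξ hK hp⟩

/-- The field generated by a countable set is countable, and so is its set of real algebraic
elements. -/
theorem exists_transcendental_of_countable {S : Set ℝ} (hS : S.Countable) :
    ∃ (K : Subfield ℝ) (ξ : ℝ), S ⊆ K ∧ Transcendental K ξ := by
  let K := Subfield.closure S
  have hK : Countable K := by
    rw [← Cardinal.mk_le_aleph0_iff]
    exact (Subfield.cardinalMk_closure_le_max S).trans (max_le hS.le_aleph0 le_rfl)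
  have h1 : {x : ℝ | IsAlgebraic K x}.Countable := Algebraic.countable K ℝ
  obtain ⟨ξ, hξ⟩ : ∃ ξ, ξ ∉ {x : ℝ | IsAlgebraic K x} := by
    by_contra! h
    exact Cardinal.not_countable_real (h1.mono fun x _ => h x)
  exact ⟨K, ξ, Subfield.subset_closure, hξ⟩

theorem singleton_mem_radicalProblem {P : Set Nat.Primes} {x : ℝ} :
    [x] ∈ radicalProblem P ↔ x ∈ radicalField P := by
  simp [radicalProblem]

/-- Rational multiples of a fixed positive real are dense. -/
theorem exists_rat_mul_mem {U : Set ℝ} {ξ : ℝ} (hU : U ∈ 𝓝 ξ) {t : ℝ} (ht : 0 < t) :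
    ∃ r : ℚ, (r : ℝ) * t ∈ U := by
  have hd : DenseRange fun r : ℚ => (r : ℝ) * t :=
    (Function.Surjective.denseRange (f := fun s : ℝ => s * t) fun y =>
      ⟨y / t, div_mul_cancel₀ y ht.ne'⟩).comp (Rat.denseRange_cast (𝕜 := ℝ)) (by fun_prop)
  obtain ⟨r, hr⟩ := hd.exists_mem_open isOpen_interior ⟨ξ, mem_interior_iff_mem_nhds.2 hU⟩
  exact ⟨r, interior_subset hr⟩

/-- Near a generic point, `F_Q` cannot tell the point from suitable multiples of radicals of `p`. -/
theorem eventually_word_notMem {K : Subfield ℝ} {ξ : ℝ} (hξ : Transcendental K ξ)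
    {Q : Set Nat.Primes} (hK : ∀ x ∈ radicalField Q, x ∈ K) {p : Nat.Primes} (hp : p ∉ Q)
    (δ : List (ℝ → ℝ)) (hδ : ∀ f ∈ δ, IsRationalAt K ξ f) :
    ∃ k₀ : ℕ, ∀ k ≥ k₀, ∀ᶠ x in 𝓝 ξ,
      (∃ r : ℚ, x = r * ((p : ℕ) : ℝ) ^ ((1 : ℝ) / ((3 ^ k : ℕ) : ℝ))) →
        (δ.map (· x) ∈ radicalProblem Q ↔ δ.map (· ξ) ∈ radicalProblem Q) := by
  have hlen : ∀ w ∈ radicalProblem Q, w.length = 1 := by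
    rintro _ ⟨x, -, rfl⟩; rfl
  by_cases hl : δ.length = 1
  swap
  · refine ⟨0, fun k _ => .of_forall fun x _ => iff_of_false ?_ ?_⟩
    all_goals exact fun h => hl (by simpa using hlen _ h)
  obtain ⟨f, rfl⟩ := List.length_eq_one_iff.1 hl
  simp only [List.map_cons, List.map_nil, singleton_mem_radicalProblem]
  have hf := hδ f (by simp)
  by_cases hconst : ∃ a, ∀ᶠ x in 𝓝 ξ, f x = a
  · obtain ⟨a, ha⟩ := hconst
    refine ⟨0, fun k _ => ?_⟩
    filter_upwards [ha] with x hx _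
    rw [hx, ha.self_of_nhds]
  -- A value in `F_Q ⊆ K` at the generic point would make `f` locally constant.
  have hfξ : f ξ ∉ radicalField Q := fun h =>
    hconst ⟨_, hf.eventually_eq_const hξ (hK _ h) rfl⟩
  obtain ⟨A, B, hB, hAB⟩ := hf
  have hBne := eventually_aeval_ne_zero hξ hB
  obtain ⟨k₀, hk₀⟩ := finite_radical_mem_radicalField hp (A := A.map (algebraMap K ℝ))
    (B := B.map (algebraMap K ℝ)) (by
      intro y hy
      refine hconst ⟨y, ?_⟩
      filter_upwards [hAB, hBne] with x hx hBx
      have := congrArg (eval x) hy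
      rw [eval_mul, eval_C, eval_map_algebraMap, eval_map_algebraMap] at this
      rw [hx, this, mul_div_cancel_right₀ _ hBx])
  refine ⟨k₀, fun k hk => ?_⟩
  have hfin := hk₀ k hk
  -- The finite set of multiples of the radical that `f` sends into `F_Q` does not contain `ξ`, so
  -- it is avoided by a neighbourhood.
  have hmem := hfin.isClosed.isOpen_compl.mem_nhds (x := ξ) (by
    rintro ⟨-, hBξ, y, hy, hxy⟩
    rw [eval_map_algebraMap] at hBξ
    rw [eval_map_algebraMap, eval_map_algebraMap] at hxy
    refine hfξ ?_
    rwa [hAB.self_of_nhds, hxy, mul_div_cancel_right₀ _ hBξ])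
  filter_upwards [hAB, hBne, hmem] with x hx hBx hmem hr
  refine iff_of_false (fun h => hmem ⟨hr, ?_, f x, h, ?_⟩) hfξ
  · rwa [eval_map_algebraMap]
  · rw [eval_map_algebraMap, eval_map_algebraMap, hx, div_mul_cancel₀ _ hBx]

/-- For `p ∈ P \ Q`, some rational multiple of a radical of `p` is close enough to `ξ` to receive
the same oracle answers. It lies in `F_P`, so `ξ` would too, contradicting transcendence. -/
theorem subset_of_genericallyReducible {K : Subfield ℝ} {ξ : ℝ} (hξ : Transcendental K ξ)
    (hK : ∀ x : ℝ, IsAlgebraic ℚ x → x ∈ K) {P Q : Set Nat.Primes}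
    (h : GenericallyReducible K ξ (radicalProblem P) (radicalProblem Q)) : P ⊆ Q := by
  intro p hp
  by_contra hpQ
  have hKF : ∀ (R : Set Nat.Primes), ∀ x ∈ radicalField R, x ∈ K := fun R x hx =>
    hK x (mem_algebraicClosure_iff.1 (radicalField_le_algebraicClosure R hx))
  obtain ⟨Δ, hΔ, hev⟩ := h [fun x => x] (by simpa using IsRationalAt.id)
  have key : ∀ Δ : List (List (ℝ → ℝ)), (∀ δ ∈ Δ, ∀ f ∈ δ, IsRationalAt K ξ f) →
      ∃ k₀ : ℕ, ∀ k ≥ k₀, ∀ᶠ x in 𝓝 ξ,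
        (∃ r : ℚ, x = r * ((p : ℕ) : ℝ) ^ ((1 : ℝ) / ((3 ^ k : ℕ) : ℝ))) →
          ∀ δ ∈ Δ, (δ.map (· x) ∈ radicalProblem Q ↔ δ.map (· ξ) ∈ radicalProblem Q) := by
    intro Δ
    induction Δ with
    | nil => simp
    | cons δ Δ ih =>
      intro hΔ
      rw [List.forall_mem_cons] at hΔ
      obtain ⟨k₁, h₁⟩ := eventually_word_notMem hξ (hKF Q) hpQ δ hΔ.1
      obtain ⟨k₂, h₂⟩ := ih hΔ.2
      refine ⟨max k₁ k₂, fun k hk => ?_⟩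
      filter_upwards [h₁ k (le_of_max_le_left hk), h₂ k (le_of_max_le_right hk)] with x h1 h2 hr
      exact List.forall_mem_cons.2 ⟨h1 hr, h2 hr⟩
  obtain ⟨k, hk⟩ := key Δ hΔ
  have hp0 : (0 : ℝ) < (p : ℕ) := by exact_mod_cast p.2.pos
  obtain ⟨r, hr⟩ := exists_rat_mul_mem (hev.and (hk k le_rfl))
    (Real.rpow_pos_of_pos hp0 ((1 : ℝ) / ((3 ^ k : ℕ) : ℝ)))
  have hiff := hr.1 (hr.2 ⟨r, rfl⟩)
  simp only [List.map_cons, List.map_nil, singleton_mem_radicalProblem] at hiff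
  have hmem : ξ ∈ radicalField P := by
    refine hiff.1 (mul_mem ?_ (radical_mem_radicalField hp (Nat.one_le_pow _ _ (by norm_num))))
    simp
  exact hξ (isAlgebraic_algebraMap (⟨ξ, hKF P ξ hmem⟩ : K))

/-- A chain of reductions from `F_P` to `F_Q` forces `P ⊆ Q`. -/
theorem subset_of_reducible_chain {P Q : Set Nat.Primes} {A B C : Problem}
    (h₁ : Reducible (radicalProblem P) A) (h₂ : Reducible A B) (h₃ : Reducible B C)
    (h₄ : Reducible C (radicalProblem Q)) : P ⊆ Q := by
  obtain ⟨S₁, hS₁, h₁⟩ := h₁.generically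
  obtain ⟨S₂, hS₂, h₂⟩ := h₂.generically
  obtain ⟨S₃, hS₃, h₃⟩ := h₃.generically
  obtain ⟨S₄, hS₄, h₄⟩ := h₄.generically
  obtain ⟨K, ξ, hK, hξ⟩ := exists_transcendental_of_countable
    ((hS₁.union hS₂).union ((hS₃.union hS₄).union (Algebraic.countable ℚ ℝ)))
  simp only [Set.union_subset_iff] at hK
  exact subset_of_genericallyReducible hξ (fun x hx => hK.2.2 hx)
    ((((h₁ K ξ hK.1.1 hξ).trans (h₂ K ξ hK.1.2 hξ)).trans (h₃ K ξ hK.2.1.1 hξ)).trans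
      (h₄ K ξ hK.2.1.2 hξ))

end Generic

/-! ### Running machines -/

section Run

open Relation

/-- Reachability of configurations. -/
abbrev Program.Reaches (p : Program) (B : Problem) : Config → Config → Prop :=
  ReflTransGen fun d e => p.step B d = some e

variable {p : Program} {B : Problem} {n i j : ℕ} {ρ : ℤ → ℝ}

theorem step_arith {o : ArithOp} {s k l : ℤ} {a : ℝ}
    (h : p[n]? = some (.arith o s k l .keep .keep)) (ha : o.eval (ρ k) (ρ l) = some a) :
    p.step B ⟨n, i, j, ρ⟩ = some ⟨n + 1, i, j, Function.update ρ s a⟩ := by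
  simp [Program.step, h, Instr.exec, ha, IndexOp.eval]

theorem step_const {s : ℤ} {a : ℝ} (h : p[n]? = some (.const s a .keep .keep)) :
    p.step B ⟨n, i, j, ρ⟩ = some ⟨n + 1, i, j, Function.update ρ s a⟩ := by
  simp [Program.step, h, Instr.exec, IndexOp.eval]

theorem step_branch_pos {t : ℕ} (h : p[n]? = some (.branch t)) (h0 : 0 ≤ ρ 0) :
    p.step B ⟨n, i, j, ρ⟩ = some ⟨t, i, j, ρ⟩ := by
  simp [Program.step, h, Instr.exec, h0]

theorem step_branch_neg {t : ℕ} (h : p[n]? = some (.branch t)) (h0 : ρ 0 < 0) :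
    p.step B ⟨n, i, j, ρ⟩ = some ⟨n + 1, i, j, ρ⟩ := by
  simp [Program.step, h, Instr.exec, h0.not_ge]

theorem step_query_mem {t : ℕ} {w : List ℝ} (h : p[n]? = some (.query t))
    (hw : (⟨n, i, j, ρ⟩ : Config).word = some w) (hm : w ∈ B) :
    p.step B ⟨n, i, j, ρ⟩ = some ⟨t, i, j, ρ⟩ := by
  simp [Program.step, h, Instr.exec, hw, hm]

theorem step_query_notMem {t : ℕ} {w : List ℝ} (h : p[n]? = some (.query t))
    (hw : (⟨n, i, j, ρ⟩ : Config).word = some w) (hm : w ∉ B) :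
    p.step B ⟨n, i, j, ρ⟩ = some ⟨n + 1, i, j, ρ⟩ := by
  simp [Program.step, h, Instr.exec, hw, hm]

theorem step_div_zero {s k l : ℤ} (h : p[n]? = some (.arith .div s k l .keep .keep))
    (h0 : ρ l = 0) : p.step B ⟨n, i, j, ρ⟩ = none := by
  simp [Program.step, h, Instr.exec, ArithOp.eval, h0]

/-- From a configuration that leads to a stop, there is no infinite computation. -/
theorem acc_of_reaches {c d : Config} (h : p.Reaches B c d) (hd : p.length ≤ d.label) :
    Acc (TransGen fun e c => p.step B c = some e) c := by
  refine Acc.transGen ?_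
  induction h using ReflTransGen.head_induction_on with
  | refl => exact ⟨_, fun e he => by rw [step_eq_none B hd] at he; cases he⟩
  | head h _ ih => exact ⟨_, fun e he => by rw [h] at he; cases he; exact ih⟩

/-- A computation which passes infinitely often through a set never stops. -/
theorem not_reaches_of_invariant {S : Set Config}
    (hS : ∀ c ∈ S, ∃ d ∈ S, TransGen (fun c d => p.step B c = some d) c d) {c d : Config}
    (hc : c ∈ S) (hd : p.length ≤ d.label) : ¬ p.Reaches B c d := by
  intro h
  -- A computation that stops makes the step relation well-founded from its start, whereas the
  -- invariant always allows a further return to `S`.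
  have hacc := acc_of_reaches h hd
  clear h
  induction hacc with
  | intro c _ ih =>
    obtain ⟨e, he, hce⟩ := hS c hc
    exact ih e (transGen_swap.1 hce) he

theorem halts_iff_of_reaches {x : List ℝ} {c : Config} (h : p.Reaches B (Config.init x) c)
    (hl : c.label < p.length) :
    p.Halts B x ↔ ∃ d, p.Reaches B c d ∧ p.length ≤ d.label := by
  have hu : Relator.RightUnique (fun d e => p.step B d = some e) := fun a b c h1 h2 =>
    Option.some.inj (h1.symm.trans h2)
  constructor
  · rintro ⟨d, hd, hdl⟩
    rcases ReflTransGen.total_of_right_unique hu h hd with h' | h'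
    · exact ⟨d, h', hdl⟩
    · rcases h'.cases_head with h' | ⟨e, h', -⟩
      · exact absurd (h' ▸ hdl) hl.not_ge
      · rw [step_eq_none B hdl] at h'; cases h'
  · rintro ⟨d, hd, hdl⟩
    exact ⟨d, h.trans hd, hdl⟩

theorem init_singleton (x : ℝ) :
    Config.init [x] = ⟨0, 1, 1, fun k => if k = 0 then 1 else if k = 1 then x else 0⟩ := by
  ext1
  · rfl
  · rfl
  · rfl
  · funext k
    simp only [Config.init, List.length_singleton, Nat.cast_one]
    split_ifs with h1 h2 h3 h4
    · rfl
    · subst h3; rfl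
    · have : k.toNat - 1 ≠ 0 := by omega
      rw [List.getD_eq_getElem?_getD, List.getElem?_eq_none (by simp; omega)]
      rfl
    · omega
    · rfl

theorem word_eq_some {c : Config} {w : List ℝ} (h0 : c.reg 0 = w.length)
    (h : ∀ (k : ℕ) (hk : k < w.length), c.reg ((k : ℤ) + 1) = w[k]) : c.word = some w := by
  have key : ∀ n : ℕ, c.reg 0 = n →
      c.word = some (List.ofFn fun k : Fin n => c.reg ((k : ℤ) + 1)) := by
    intro n hn
    unfold Config.word
    simp only [hn, Nat.floor_natCast, if_true]
    rfl
  rw [key _ h0]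
  refine congrArg some (List.ext_getElem (by simp) fun m hm hm' => ?_)
  rw [List.getElem_ofFn]
  exact h m hm'

theorem word_init (x : List ℝ) : (Config.init x).word = some x := by
  refine word_eq_some (by simp [Config.init]) fun k hk => ?_
  simp only [Config.init]
  rw [if_neg (by omega), if_pos (by omega)]
  have : ((k : ℤ) + 1).toNat - 1 = k := by omega
  rw [this, List.getD_eq_getElem?_getD, List.getElem?_eq_getElem hk]
  rfl

end Run

/-! ### The search machine -/

section Search

open Relation

/-- A machine which reads from the digits of the constant `c` a list of tests, and looks for a
test that its input satisfies. Digit `0` increments the accumulator `-3`, digit `1` decrements it,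
digit `2` multiplies it by the input; digit `3` sets the flag `-4` if the accumulator is negative,
and clears the accumulator; digits `4` and `5` stop with output `1` and `0` if the flag is not
set, and clear it otherwise. -/
def searchProgram (I : Instr) (c : ℝ) : Program :=
  -- The entry `I` is `.query 10` for deciding with an oracle, or `.branch 4` for semi-deciding
  -- without one. Register `-1` is never written and supplies `0`; registers `-5` and `-6` hold `1`
  -- and `10`, and `-2` holds the unread digits.
  [I,
    .const 0 1 .keep .keep, .const 1 0 .keep .keep, .branch 57,
    -- 4: verification that the input has size one
    .const (-5) 1 .keep .keep, .arith .sub 0 0 (-5) .keep .keep, .arith .mul (-2) 0 0 .keep .keep,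
    -- The branch tests `0 ≤ -(n - 1)²`, that is, size `n = 1`. For other sizes the division by zero
    -- blocks the machine for good.
    .arith .sub 0 (-1) (-2) .keep .keep, .branch 10, .arith .div 0 0 (-1) .keep .keep,
    -- 10: initialization
    .const (-5) 1 .keep .keep, .const (-6) 10 .keep .keep, .const (-2) c .keep .keep,
    -- 13: the next digit
    .arith .mul 0 (-2) (-6) .keep .keep,
    -- 14: digit 0
    .arith .sub 0 0 (-5) .keep .keep, .branch 20, .arith .add (-2) 0 (-5) .keep .keep,
    .arith .add (-3) (-3) (-5) .keep .keep, .const 0 0 .keep .keep, .branch 13,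
    -- 20: digit 1
    .arith .sub 0 0 (-5) .keep .keep, .branch 26, .arith .add (-2) 0 (-5) .keep .keep,
    .arith .sub (-3) (-3) (-5) .keep .keep, .const 0 0 .keep .keep, .branch 13,
    -- 26: digit 2
    .arith .sub 0 0 (-5) .keep .keep, .branch 32, .arith .add (-2) 0 (-5) .keep .keep,
    .arith .mul (-3) (-3) 1 .keep .keep, .const 0 0 .keep .keep, .branch 13,
    -- 32: digit 3
    .arith .sub 0 0 (-5) .keep .keep, .branch 41, .arith .add (-2) 0 (-5) .keep .keep,
    .arith .add 0 (-3) (-1) .keep .keep, .const (-3) 0 .keep .keep, .branch 39,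
    .const (-4) 1 .keep .keep, .const 0 0 .keep .keep, .branch 13,
    -- 41: digit 4
    .arith .sub 0 0 (-5) .keep .keep, .branch 49, .arith .add (-2) 0 (-5) .keep .keep,
    .arith .sub 0 (-1) (-4) .keep .keep, .branch 55, .const (-4) 0 .keep .keep,
    .const 0 0 .keep .keep, .branch 13,
    -- 49: digit 5
    .arith .add (-2) 0 (-1) .keep .keep,
    .arith .sub 0 (-1) (-4) .keep .keep, .branch 1, .const (-4) 0 .keep .keep,
    .const 0 0 .keep .keep, .branch 13,
    -- 55: output 1
    .const 0 1 .keep .keep, .const 1 1 .keep .keep]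

/-- The registers of the search machine. -/
def searchReg (v x s y z : ℝ) : ℤ → ℝ := fun k =>
  if k = 0 then v else if k = 1 then x else if k = -2 then s else if k = -3 then y
  else if k = -4 then z else if k = -5 then 1 else if k = -6 then 10 else 0

section

variable (v x s y z a : ℝ)

theorem update_searchReg_zero :
    Function.update (searchReg v x s y z) 0 a = searchReg a x s y z := by
  funext k; by_cases h : k = 0 <;> simp [searchReg, h]

theorem update_searchReg_one :
    Function.update (searchReg v x s y z) 1 a = searchReg v a s y z := by
  funext k; by_cases h : k = 1 <;> simp [searchReg, h]

theorem update_searchReg_neg_two :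
    Function.update (searchReg v x s y z) (-2) a = searchReg v x a y z := by
  funext k; by_cases h : k = -2 <;> simp [searchReg, h]

theorem update_searchReg_neg_three :
    Function.update (searchReg v x s y z) (-3) a = searchReg v x s a z := by
  funext k; by_cases h : k = -3 <;> simp [searchReg, h]

theorem update_searchReg_neg_four :
    Function.update (searchReg v x s y z) (-4) a = searchReg v x s y a := by
  funext k; by_cases h : k = -4 <;> simp [searchReg, h]

end

/-- A configuration of the search machine. -/
def searchConfig (n : ℕ) (v x s y z : ℝ) : Config := ⟨n, 1, 1, searchReg v x s y z⟩

variable {I : Instr} {c : ℝ} {B : Problem} {v x s y z : ℝ}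

/-- Reading a digit that is at least `1` at the instructions `n` and `n + 1`. -/
theorem search_next {n t : ℕ}
    (h₁ : (searchProgram I c)[n]? = some (.arith .sub 0 0 (-5) .keep .keep))
    (h₂ : (searchProgram I c)[n + 1]? = some (.branch t)) (hv : 1 ≤ v) :
    (searchProgram I c).Reaches B (searchConfig n v x s y z) (searchConfig t (v - 1) x s y z) := by
  refine .head (step_arith h₁ rfl) (.head (step_branch_pos h₂ ?_) ?_)
  · rw [update_searchReg_zero]
    exact sub_nonneg.2 hv
  · rw [update_searchReg_zero]
    exact .refl

/-- Reading a digit `0` at the instructions `n` to `n + 2`. -/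
theorem search_found {n t : ℕ}
    (h₁ : (searchProgram I c)[n]? = some (.arith .sub 0 0 (-5) .keep .keep))
    (h₂ : (searchProgram I c)[n + 1]? = some (.branch t))
    (h₃ : (searchProgram I c)[n + 2]? = some (.arith .add (-2) 0 (-5) .keep .keep)) (hv : v < 1) :
    (searchProgram I c).Reaches B (searchConfig n v x s y z)
      (searchConfig (n + 3) (v - 1) x v y z) := by
  refine .head (step_arith h₁ rfl) ?_
  rw [update_searchReg_zero]
  refine .head (step_branch_neg h₂ (sub_neg.2 hv)) (.head (step_arith h₃ rfl) ?_)
  rw [update_searchReg_neg_two]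
  have : searchReg (searchReg v x s y z 0 - searchReg v x s y z (-5)) x s y z 0 +
    searchReg (searchReg v x s y z 0 - searchReg v x s y z (-5)) x s y z (-5) = v :=
    sub_add_cancel v 1
  rw [this]
  exact .refl

/-- Going back to the next digit. -/
theorem search_back {n : ℕ} (h₁ : (searchProgram I c)[n]? = some (.const 0 0 .keep .keep))
    (h₂ : (searchProgram I c)[n + 1]? = some (.branch 13)) :
    (searchProgram I c).Reaches B (searchConfig n v x s y z) (searchConfig 13 0 x s y z) := by
  refine .head (step_const h₁) ?_
  rw [update_searchReg_zero]
  exact .head (step_branch_pos h₂ le_rfl) .refl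

/-- The effect of a digit on the accumulator and the flag. -/
def digitEffect (x : ℝ) (d : ℕ) (q : ℝ × ℝ) : ℝ × ℝ :=
  match d with
  | 0 => (q.1 + 1, q.2)
  | 1 => (q.1 - 1, q.2)
  | 2 => (q.1 * x, q.2)
  | 3 => (0, if q.1 < 0 then 1 else q.2)
  | _ => (q.1, 0)

/-- Multiplication by ten exposes `d + s`. Each block subtracts `1` and passes on while the result
is nonnegative, so the block of digit `d` is entered with `s` left. At least one step is made, which
the proof of nontermination uses. -/
theorem search_read (hs : 0 ≤ s) {d : ℕ} (hd : d ≤ 5) :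
    TransGen (fun d e => (searchProgram I c).step B d = some e)
      (searchConfig 13 0 x ((d + s) / 10) y z)
      (searchConfig ([14, 20, 26, 32, 41, 49].getD d 0) s x ((d + s) / 10) y z) := by
  have h0 : (searchProgram I c).step B (searchConfig 13 0 x ((d + s) / 10) y z) =
      some (searchConfig 14 (d + s) x ((d + s) / 10) y z) := by
    rw [searchConfig, step_arith (n := 13) rfl rfl, update_searchReg_zero]
    have : searchReg 0 x ((d + s) / 10) y z (-2) * searchReg 0 x ((d + s) / 10) y z (-6) = d + s :=
      div_mul_cancel₀ _ (by norm_num)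
    rw [this]
    rfl
  refine .head' h0 ?_
  generalize ((d : ℝ) + s) / 10 = r
  have e0 : ∀ v : ℝ, 1 ≤ v → (searchProgram I c).Reaches B (searchConfig 14 v x r y z)
      (searchConfig 20 (v - 1) x r y z) := fun v hv => search_next rfl rfl hv
  have e1 : ∀ v : ℝ, 1 ≤ v → (searchProgram I c).Reaches B (searchConfig 20 v x r y z)
      (searchConfig 26 (v - 1) x r y z) := fun v hv => search_next rfl rfl hv
  have e2 : ∀ v : ℝ, 1 ≤ v → (searchProgram I c).Reaches B (searchConfig 26 v x r y z)
      (searchConfig 32 (v - 1) x r y z) := fun v hv => search_next rfl rfl hv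
  have e3 : ∀ v : ℝ, 1 ≤ v → (searchProgram I c).Reaches B (searchConfig 32 v x r y z)
      (searchConfig 41 (v - 1) x r y z) := fun v hv => search_next rfl rfl hv
  have e4 : ∀ v : ℝ, 1 ≤ v → (searchProgram I c).Reaches B (searchConfig 41 v x r y z)
      (searchConfig 49 (v - 1) x r y z) := fun v hv => search_next rfl rfl hv
  have f0 : (searchProgram I c).Reaches B (searchConfig 14 s x r y z)
      (searchConfig 14 s x r y z) := .refl
  have f1 : (searchProgram I c).Reaches B (searchConfig 14 (1 + s) x r y z)
      (searchConfig 20 s x r y z) := by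
    simpa using e0 (1 + s) (by linarith)
  have f2 : (searchProgram I c).Reaches B (searchConfig 14 (2 + s) x r y z)
      (searchConfig 26 s x r y z) := by
    have := (e0 (2 + s) (by linarith)).trans (e1 _ (by linarith))
    rwa [show 2 + s - 1 - 1 = s by ring] at this
  have f3 : (searchProgram I c).Reaches B (searchConfig 14 (3 + s) x r y z)
      (searchConfig 32 s x r y z) := by
    have := ((e0 (3 + s) (by linarith)).trans (e1 _ (by linarith))).trans (e2 _ (by linarith))
    rwa [show 3 + s - 1 - 1 - 1 = s by ring] at this
  have f4 : (searchProgram I c).Reaches B (searchConfig 14 (4 + s) x r y z)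
      (searchConfig 41 s x r y z) := by
    have := (((e0 (4 + s) (by linarith)).trans (e1 _ (by linarith))).trans
      (e2 _ (by linarith))).trans (e3 _ (by linarith))
    rwa [show 4 + s - 1 - 1 - 1 - 1 = s by ring] at this
  have f5 : (searchProgram I c).Reaches B (searchConfig 14 (5 + s) x r y z)
      (searchConfig 49 s x r y z) := by
    have := ((((e0 (5 + s) (by linarith)).trans (e1 _ (by linarith))).trans
      (e2 _ (by linarith))).trans (e3 _ (by linarith))).trans (e4 _ (by linarith))
    rwa [show 5 + s - 1 - 1 - 1 - 1 - 1 = s by ring] at this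
  interval_cases d
  · simpa using f0
  · simpa using f1
  · simpa using f2
  · simpa using f3
  · simpa using f4
  · simpa using f5

/-- One digit is processed without stopping. -/
theorem search_digit (hs : 0 ≤ s) (hs1 : s < 1) {d : ℕ} (hd : d ≤ 5) (hz : 4 ≤ d → z = 1) :
    TransGen (fun d e => (searchProgram I c).step B d = some e)
      (searchConfig 13 0 x ((d + s) / 10) y z)
      (searchConfig 13 0 x s (digitEffect x d (y, z)).1 (digitEffect x d (y, z)).2) := by
  refine (search_read hs hd).trans_left ?_
  generalize ((d : ℝ) + s) / 10 = r
  interval_cases d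
  · refine (search_found rfl rfl rfl hs1).trans (.head (step_arith rfl rfl) ?_)
    rw [update_searchReg_neg_three]
    exact search_back rfl rfl
  · refine (search_found rfl rfl rfl hs1).trans (.head (step_arith rfl rfl) ?_)
    rw [update_searchReg_neg_three]
    exact search_back rfl rfl
  · refine (search_found rfl rfl rfl hs1).trans (.head (step_arith rfl rfl) ?_)
    rw [update_searchReg_neg_three]
    exact search_back rfl rfl
  · refine (search_found rfl rfl rfl hs1).trans (.head (step_arith rfl rfl) ?_)
    rw [update_searchReg_zero]
    refine .head (step_const rfl) ?_
    rw [update_searchReg_neg_three]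
    have hy : searchReg (s - 1) x s y z (-3) + searchReg (s - 1) x s y z (-1) = y := add_zero y
    rw [hy]
    by_cases h : y < 0
    · refine .head (step_branch_neg rfl h) (.head (step_const rfl) ?_)
      rw [update_searchReg_neg_four]
      simp only [digitEffect, if_pos h]
      exact search_back rfl rfl
    · refine .head (step_branch_pos rfl (not_lt.1 h)) ?_
      simp only [digitEffect, if_neg h]
      exact search_back rfl rfl
  · obtain rfl := hz le_rfl
    refine (search_found rfl rfl rfl hs1).trans (.head (step_arith rfl rfl) ?_)
    rw [update_searchReg_zero]
    have hy : searchReg (s - 1) x s y 1 (-1) - searchReg (s - 1) x s y 1 (-4) = -1 := zero_sub 1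
    rw [hy]
    refine .head (step_branch_neg rfl (by norm_num [searchReg])) (.head (step_const rfl) ?_)
    rw [update_searchReg_neg_four]
    exact search_back rfl rfl
  · obtain rfl := hz (by norm_num)
    refine .head (step_arith rfl rfl) ?_
    rw [update_searchReg_neg_two]
    have hy : searchReg s x r y 1 0 + searchReg s x r y 1 (-1) = s := add_zero s
    rw [hy]
    refine .head (step_arith rfl rfl) ?_
    rw [update_searchReg_zero]
    have hy : searchReg s x s y 1 (-1) - searchReg s x s y 1 (-4) = -1 := zero_sub 1
    rw [hy]
    refine .head (step_branch_neg rfl (by norm_num [searchReg])) (.head (step_const rfl) ?_)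
    rw [update_searchReg_neg_four]
    exact search_back rfl rfl

/-- The output of `0`, from instruction `1`. -/
theorem search_reject {i j : ℕ} {ρ : ℤ → ℝ} :
    ∃ d, (searchProgram I c).Reaches B ⟨1, i, j, ρ⟩ d ∧ d.label = 57 ∧ d.word = some [0] := by
  refine ⟨⟨57, i, j, Function.update (Function.update ρ 0 1) 1 0⟩,
    .head (step_const rfl) (.head (step_const rfl) (.head (step_branch_pos rfl ?_) .refl)), rfl, ?_⟩
  · simp
  · simp [word_eq_singleton]

/-- A final digit read with the flag clear means that the preceding test succeeded; the digit itself
is the stored answer. -/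
theorem search_stop (hs : 0 ≤ s) (hs1 : s < 1) {d : ℕ} (hd : d ≤ 5) (hd4 : 4 ≤ d) :
    ∃ e, (searchProgram I c).Reaches B (searchConfig 13 0 x ((d + s) / 10) y 0) e ∧
      e.label = 57 ∧ e.word = some [if d = 4 then 1 else 0] := by
  have hread := (search_read (I := I) (c := c) (B := B) (x := x) (y := y) (z := 0) hs
    hd).to_reflTransGen
  revert hread
  generalize ((d : ℝ) + s) / 10 = r
  intro hread
  interval_cases d
  · refine ⟨searchConfig 57 1 1 s y 0, hread.trans ?_, rfl, ?_⟩
    swap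
    · rw [word_eq_singleton, if_pos rfl]
      exact ⟨rfl, rfl⟩
    refine (search_found rfl rfl rfl hs1).trans (.head (step_arith rfl rfl) ?_)
    rw [update_searchReg_zero]
    refine .head (step_branch_pos rfl ?_) (.head (step_const rfl) ?_)
    · exact (sub_zero (0 : ℝ)).ge
    rw [update_searchReg_zero]
    refine .head (step_const rfl) ?_
    rw [update_searchReg_one]
    exact .refl
  · obtain ⟨e, he, hl, hw⟩ := search_reject (I := I) (c := c) (B := B) (i := 1) (j := 1)
      (ρ := searchReg 0 x s y 0)
    refine ⟨e, hread.trans (.trans ?_ he), hl, by simpa using hw⟩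
    refine .head (step_arith rfl rfl) ?_
    rw [update_searchReg_neg_two]
    have hy : searchReg s x r y 0 0 + searchReg s x r y 0 (-1) = s := add_zero s
    rw [hy]
    refine .head (step_arith rfl rfl) ?_
    rw [update_searchReg_zero]
    have hy : searchReg s x s y 0 (-1) - searchReg s x s y 0 (-4) = 0 := sub_zero 0
    rw [hy]
    exact .head (step_branch_pos rfl le_rfl) .refl

end Search

section Search

open Relation Filter Topology Polynomial

/-! ### Real numbers as streams of digits -/

/-- The real number with the decimal digits `u`, followed by those of `s`. -/
def prependDigits (u : List ℕ) (s : ℝ) : ℝ := u.foldr (fun (d : ℕ) s => ((d : ℝ) + s) / 10) s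

theorem prependDigits_mono (u : List ℕ) : Monotone (prependDigits u) := by
  induction u with
  | nil => exact monotone_id
  | cons d u ih =>
    intro s t h
    have := ih h
    simp only [prependDigits, List.foldr_cons] at this ⊢
    linarith

theorem continuous_prependDigits (u : List ℕ) : Continuous (prependDigits u) := by
  induction u with
  | nil => exact continuous_id
  | cons d u ih => exact (continuous_const.add ih).div_const 10

/-- With digits at most `5` the interval up to `2/3` is stable, since `(5 + 2/3) / 10 ≤ 2/3`. Tails
thus stay below `1` and every digit can be read off unambiguously. -/
theorem prependDigits_mem {u : List ℕ} (hu : ∀ d ∈ u, d ≤ 5) {s : ℝ} (h0 : 0 ≤ s)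
    (h1 : s ≤ 2 / 3) : 0 ≤ prependDigits u s ∧ prependDigits u s ≤ 2 / 3 := by
  induction u with
  | nil => exact ⟨h0, h1⟩
  | cons d u ih =>
    rw [List.forall_mem_cons] at hu
    have hd : (d : ℝ) ≤ 5 := by exact_mod_cast hu.1
    obtain ⟨h2, h3⟩ := ih hu.2
    simp only [prependDigits, List.foldr_cons] at h2 h3 ⊢
    constructor
    · positivity
    · linarith

/-- Every sequence of words is the stream of digits of a real number. -/
theorem exists_digit_stream (b : ℕ → List ℕ) (hb : ∀ n, ∀ d ∈ b n, d ≤ 5) :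
    ∃ σ : ℕ → ℝ, ∀ n, 0 ≤ σ n ∧ σ n < 1 ∧ σ n = prependDigits (b n) (σ (n + 1)) := by
  -- `F N n` is the number with blocks `n, …, n + N - 1` followed by zeros. It increases with `N`,
  -- and continuity of prepending carries the recursion over to the limit.
  let F : ℕ → ℕ → ℝ := fun N => Nat.rec (fun _ => 0) (fun _ f n => prependDigits (b n) (f (n + 1))) N
  have hF : ∀ N n, F (N + 1) n = prependDigits (b n) (F N (n + 1)) := fun N n => rfl
  have hbd : ∀ N n, 0 ≤ F N n ∧ F N n ≤ 2 / 3 := by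
    intro N
    induction N with
    | zero => intro n; exact ⟨le_rfl, by norm_num [F]⟩
    | succ N ih => intro n; rw [hF]; exact prependDigits_mem (hb n) (ih _).1 (ih _).2
  have hmono : ∀ N n, F N n ≤ F (N + 1) n := by
    intro N
    induction N with
    | zero => exact fun n => (hbd 1 n).1
    | succ N ih => intro n; rw [hF, hF (N + 1)]; exact prependDigits_mono _ (ih _)
  have hlim : ∀ n, Tendsto (fun N => F N n) atTop (𝓝 (⨆ N, F N n)) := fun n =>
    tendsto_atTop_ciSup (monotone_nat_of_le_succ fun N => hmono N n)
      ⟨2 / 3, by rintro _ ⟨N, rfl⟩; exact (hbd N n).2⟩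
  refine ⟨fun n => ⨆ N, F N n, fun n => ⟨?_, ?_, ?_⟩⟩
  · exact ge_of_tendsto' (hlim n) fun N => (hbd N n).1
  · have := le_of_tendsto' (hlim n) fun N => (hbd N n).2
    linarith
  · refine tendsto_nhds_unique ((tendsto_add_atTop_iff_nat 1).2 (hlim n)) ?_
    exact ((continuous_prependDigits (b n)).tendsto _).comp (hlim (n + 1))

/-! ### Tests -/

theorem foldl_replicate_zero (x y z : ℝ) (n : ℕ) :
    (List.replicate n 0).foldl (fun q d => digitEffect x d q) (y, z) = (y + n, z) := by
  induction n generalizing y with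
  | zero => simp
  | succ n ih =>
    rw [List.replicate_succ, List.foldl_cons, show digitEffect x 0 (y, z) = (y + 1, z) from rfl, ih]
    push_cast
    ring_nf

theorem foldl_replicate_one (x y z : ℝ) (n : ℕ) :
    (List.replicate n 1).foldl (fun q d => digitEffect x d q) (y, z) = (y - n, z) := by
  induction n generalizing y with
  | zero => simp
  | succ n ih =>
    rw [List.replicate_succ, List.foldl_cons, show digitEffect x 1 (y, z) = (y - 1, z) from rfl, ih]
    push_cast
    ring_nf

/-- Integral polynomials are evaluated by words of digits. -/
theorem exists_word_eval (g : ℤ[X]) :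
    ∃ u : List ℕ, (∀ d ∈ u, d ≤ 3) ∧ ∀ x z : ℝ,
      u.foldl (fun q d => digitEffect x d q) (0, z) = (aeval x g, z) := by
  induction g using Polynomial.recOnHorner with
  | M0 => exact ⟨[], by simp, by simp⟩
  | MC g a _ _ ih =>
    obtain ⟨u, hu, h⟩ := ih
    rcases Int.eq_nat_or_neg a with ⟨n, rfl | rfl⟩
    · refine ⟨u ++ List.replicate n 0, ?_, fun x z => ?_⟩
      · refine List.forall_mem_append.2 ⟨hu, fun d hd => ?_⟩
        rw [List.eq_of_mem_replicate hd]; norm_num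
      · rw [List.foldl_append, h, foldl_replicate_zero]
        simp
    · refine ⟨u ++ List.replicate n 1, ?_, fun x z => ?_⟩
      · refine List.forall_mem_append.2 ⟨hu, fun d hd => ?_⟩
        rw [List.eq_of_mem_replicate hd]; norm_num
      · rw [List.foldl_append, h, foldl_replicate_one]
        simp [sub_eq_add_neg]
  | MX g _ ih =>
    obtain ⟨u, hu, h⟩ := ih
    refine ⟨u ++ [2], ?_, fun x z => ?_⟩
    · exact List.forall_mem_append.2 ⟨hu, by simp⟩
    · rw [List.foldl_append, h]
      simp [digitEffect]

/-- Systems of integral polynomial inequalities are tested by words of digits. -/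
theorem exists_word_test (gs : List ℤ[X]) :
    ∃ u : List ℕ, (∀ d ∈ u, d ≤ 3) ∧ ∀ x z : ℝ,
      ((∀ g ∈ gs, 0 ≤ aeval x g) → u.foldl (fun q d => digitEffect x d q) (0, z) = (0, z)) ∧
      ((¬ ∀ g ∈ gs, 0 ≤ aeval x g) → u.foldl (fun q d => digitEffect x d q) (0, z) = (0, 1)) := by
  induction gs with
  | nil => exact ⟨[], by simp, by simp⟩
  | cons g gs ih =>
    obtain ⟨u, hu, h⟩ := ih
    obtain ⟨w, hw, h'⟩ := exists_word_eval g
    -- Digit `3` clears the accumulator for the remaining tests, and none of the digits up to `3`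
    -- resets the flag, so a single failure is remembered.
    refine ⟨w ++ 3 :: u, List.forall_mem_append.2 ⟨hw, List.forall_mem_cons.2 ⟨le_rfl, hu⟩⟩,
      fun x z => ?_⟩
    rw [List.foldl_append, h', List.foldl_cons, List.forall_mem_cons]
    by_cases hg : 0 ≤ aeval x g
    · rw [show digitEffect x 3 (aeval x g, z) = (0, z) by simp [digitEffect, hg.not_gt]]
      simpa only [hg, true_and] using h x z
    · rw [show digitEffect x 3 (aeval x g, z) = (0, 1) by simp [digitEffect, not_le.1 hg]]
      refine ⟨fun h => absurd h.1 hg, fun _ => ?_⟩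
      by_cases hgs : ∀ g ∈ gs, 0 ≤ aeval x g
      · exact (h x 1).1 hgs
      · exact (h x 1).2 hgs

/-- An algebraic real is determined by integral polynomial inequalities. -/
theorem exists_inequalities {a : ℝ} (ha : IsAlgebraic ℚ a) :
    ∃ gs : List ℤ[X], ∀ x : ℝ, (∀ g ∈ gs, 0 ≤ aeval x g) ↔ x = a := by
  obtain ⟨f, hf0, hf⟩ := (IsFractionRing.isAlgebraic_iff ℤ ℚ ℝ).2 ha
  -- The other roots of `f` are finitely many, so an interval with rational endpoints isolates `a`.
  -- Clearing denominators keeps all the inequalities integral.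
  have hfin : (f.rootSet ℝ \ {a}).Finite := (f.rootSet_finite ℝ).subset Set.sdiff_subset
  have hmem : (f.rootSet ℝ \ {a})ᶜ ∈ 𝓝 a :=
    hfin.isClosed.isOpen_compl.mem_nhds fun h => h.2 rfl
  obtain ⟨l, u, ⟨hl, hu⟩, hlu⟩ := mem_nhds_iff_exists_Ioo_subset.1 hmem
  obtain ⟨q, hlq, hqa⟩ := exists_rat_btwn hl
  obtain ⟨r, har, hru⟩ := exists_rat_btwn hu
  have hlow : ∀ x : ℝ, 0 ≤ aeval x (C (q.den : ℤ) * X - C q.num) ↔ (q : ℝ) ≤ x := by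
    intro x
    have hd : (0 : ℝ) < q.den := by exact_mod_cast q.den_pos
    rw [Rat.cast_def, div_le_iff₀ hd]
    simp [mul_comm]
  have hup : ∀ x : ℝ, 0 ≤ aeval x (C r.num - C (r.den : ℤ) * X) ↔ x ≤ (r : ℝ) := by
    intro x
    have hd : (0 : ℝ) < r.den := by exact_mod_cast r.den_pos
    rw [Rat.cast_def, le_div_iff₀ hd]
    simp [mul_comm]
  refine ⟨[f, -f, C (q.den : ℤ) * X - C q.num, C r.num - C (r.den : ℤ) * X], fun x => ?_⟩
  simp only [List.forall_mem_cons, hlow, hup]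
  constructor
  · rintro ⟨h1, h2, h3, h4, -⟩
    by_contra hxa
    refine hlu ⟨hlq.trans_le h3, h4.trans_lt hru⟩ ⟨(mem_rootSet_of_ne hf0).2 ?_, hxa⟩
    rw [map_neg] at h2
    linarith
  · rintro rfl
    simp [hf, hqa.le, har.le]

/-! ### The search -/

variable {I : Instr} {c : ℝ} {B : Problem} {x : ℝ}

theorem search_word {u : List ℕ} (hu : ∀ d ∈ u, d ≤ 3) {s : ℝ} (h0 : 0 ≤ s) (h1 : s ≤ 2 / 3)
    (q : ℝ × ℝ) :
    (searchProgram I c).Reaches B (searchConfig 13 0 x (prependDigits u s) q.1 q.2)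
      (searchConfig 13 0 x s (u.foldl (fun q d => digitEffect x d q) q).1
        (u.foldl (fun q d => digitEffect x d q) q).2) := by
  induction u generalizing q with
  | nil => exact .refl
  | cons d u ih =>
    rw [List.forall_mem_cons] at hu
    have hmem := prependDigits_mem (fun d hd => (hu.2 d hd).trans (by norm_num)) h0 h1
    refine (search_digit hmem.1 (hmem.2.trans_lt (by norm_num)) (hu.1.trans (by norm_num))
      fun h => ?_).to_reflTransGen.trans (ih hu.2 _)
    omega

theorem prependDigits_append (u w : List ℕ) (s : ℝ) :
    prependDigits (u ++ w) s = prependDigits u (prependDigits w s) := by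
  simp [prependDigits]

open Classical in
/-- The search machine, with a suitable constant, decides `T` on the set `S` of algebraic reals,
and does not stop outside `S`. -/
theorem exists_search {S T : Set ℝ} (hS : ∀ a ∈ S, IsAlgebraic ℚ a) (hne : S.Nonempty) :
    ∃ s : ℝ, ∀ (I : Instr) (c : ℝ) (B : Problem) (x : ℝ),
      (x ∈ S → ∃ e, (searchProgram I c).Reaches B (searchConfig 13 0 x s 0 0) e ∧
        e.label = 57 ∧ e.word = some [if x ∈ T then 1 else 0]) ∧
      (x ∉ S → ∀ e, 57 ≤ e.label →
        ¬ (searchProgram I c).Reaches B (searchConfig 13 0 x s 0 0) e) := by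
  obtain ⟨α, rfl⟩ := ((Algebraic.countable ℚ ℝ).mono hS).exists_eq_range hne
  have hw : ∀ n, ∃ u : List ℕ, (∀ d ∈ u, d ≤ 3) ∧ ∀ x : ℝ,
      u.foldl (fun q d => digitEffect x d q) (0, 0) = (0, if x = α n then 0 else 1) := by
    intro n
    obtain ⟨gs, hgs⟩ := exists_inequalities (hS (α n) ⟨n, rfl⟩)
    obtain ⟨u, hu, h⟩ := exists_word_test gs
    refine ⟨u, hu, fun x => ?_⟩
    have hx := h x 0
    rw [hgs x] at hx
    split_ifs with h
    · exact hx.1 h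
    · exact hx.2 h
  choose u hu hux using hw
  -- The test for `α n` is followed by the advice on whether `α n` belongs to `T`, so `T` may be an
  -- arbitrary set.
  let t : ℕ → ℕ := fun n => if α n ∈ T then 4 else 5
  have ht4 : ∀ n, 4 ≤ t n := fun n => by simp only [t]; split_ifs <;> norm_num
  have ht5 : ∀ n, t n ≤ 5 := fun n => by simp only [t]; split_ifs <;> norm_num
  obtain ⟨σ, hσ⟩ := exists_digit_stream (fun n => u n ++ [t n]) (fun n => by
    refine List.forall_mem_append.2 ⟨fun d hd => (hu n d hd).trans (by norm_num), ?_⟩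
    simpa using ht5 n)
  refine ⟨σ 0, fun I c B x => ?_⟩
  have hblock : ∀ n, (searchProgram I c).Reaches B (searchConfig 13 0 x (σ n) 0 0)
      (searchConfig 13 0 x ((t n + σ (n + 1)) / 10) 0 (if x = α n then 0 else 1)) := by
    intro n
    have h5 : (t n : ℝ) ≤ 5 := by exact_mod_cast ht5 n
    have h := hσ (n + 1)
    have := search_word (I := I) (c := c) (B := B) (x := x) (hu n)
      (s := (t n + σ (n + 1)) / 10) (by have := h.1; positivity) (by linarith [h.2.1]) (0, 0)
    rw [hux n x] at this
    rw [(hσ n).2.2, prependDigits_append]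
    exact this
  have hnext : ∀ n, x ≠ α n → TransGen (fun d e => (searchProgram I c).step B d = some e)
      (searchConfig 13 0 x (σ n) 0 0) (searchConfig 13 0 x (σ (n + 1)) 0 0) := by
    intro n hn
    have h := hblock n
    rw [if_neg hn] at h
    have h2 := search_digit (I := I) (c := c) (B := B) (x := x) (y := 0) (z := 1) (hσ (n + 1)).1
      (hσ (n + 1)).2.1 (ht5 n) fun _ => rfl
    have h3 : digitEffect x (t n) (0, 1) = (0, 0) := by
      simp only [t]; split_ifs <;> rfl
    rw [h3] at h2
    exact h2.trans_right h
  constructor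
  -- The search runs to the first index whose entry equals `x`; at every earlier one the flag is set
  -- and the answer is skipped.
  · intro hx
    have hex : ∃ n, x = α n := hx.imp fun n h => h.symm
    have hreach : ∀ m ≤ Nat.find hex, (searchProgram I c).Reaches B
        (searchConfig 13 0 x (σ 0) 0 0) (searchConfig 13 0 x (σ m) 0 0) := by
      intro m
      induction m with
      | zero => exact fun _ => .refl
      | succ m ih =>
        exact fun hm => (ih (by omega)).trans (hnext m (Nat.find_min hex hm)).to_reflTransGen
    set n := Nat.find hex
    have hn : x = α n := Nat.find_spec hex
    have h := hblock n
    rw [if_pos hn] at h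
    obtain ⟨e, he, hl, hw⟩ := search_stop (I := I) (c := c) (B := B) (x := x) (y := 0)
      (hσ (n + 1)).1 (hσ (n + 1)).2.1 (ht5 n) (ht4 n)
    refine ⟨e, ((hreach n le_rfl).trans h).trans he, hl, ?_⟩
    rw [hw, hn]
    by_cases hT : α n ∈ T <;> simp [t, hT]
  · intro hx e he
    refine not_reaches_of_invariant (S := Set.range fun n => searchConfig 13 0 x (σ n) 0 0)
      ?_ ⟨0, rfl⟩ he
    rintro _ ⟨n, rfl⟩
    exact ⟨_, ⟨n + 1, rfl⟩, hnext n fun h => hx ⟨n, h.symm⟩⟩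

/-- The initialization of the search machine on an input of size one. -/
theorem search_init {v s : ℝ} {ρ : ℤ → ℝ} (h1 : ρ 0 = v)
    (h : ∀ k, k ≠ 0 → k ≠ -2 → k ≠ -5 → ρ k = if k = 1 then x else 0) :
    (searchProgram I s).Reaches B ⟨10, 1, 1, ρ⟩ (searchConfig 13 v x s 0 0) := by
  refine .head (step_const rfl) (.head (step_const rfl) (.head (step_const rfl) ?_))
  have : Function.update (Function.update (Function.update ρ (-5) 1) (-6) 10) (-2) s =
      searchReg v x s 0 0 := by
    funext k
    simp only [Function.update_apply, searchReg]
    split_ifs <;> first | rfl | (subst_vars; first | rfl | omega) | simp_all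
  rw [this]
  exact .refl

end Search

/-! ### Reduction and semi-decision by search -/

section Search

open Relation

/-- The sequences of size one with entry in `S`. -/
def singletons (S : Set ℝ) : Problem := {w | ∃ x ∈ S, w = [x]}

theorem singleton_mem_singletons {S : Set ℝ} {x : ℝ} : [x] ∈ singletons S ↔ x ∈ S := by
  simp [singletons]

/-- Instruction `13` overwrites register `0`, so the size `1` left there by the input does not
matter. -/
theorem search_reaches_iff {I : Instr} {c : ℝ} {B : Problem} {v x s y z : ℝ} {e : Config}
    (he : 57 ≤ e.label) :
    (searchProgram I c).Reaches B (searchConfig 13 v x s y z) e ↔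
      (searchProgram I c).Reaches B (searchConfig 13 0 x s y z) e := by
  have hstep : ∀ v, (searchProgram I c).step B (searchConfig 13 v x s y z) =
      some (searchConfig 14 (s * 10) x s y z) := by
    intro v
    rw [searchConfig, step_arith (n := 13) rfl rfl, update_searchReg_zero]
    rfl
  have key : ∀ v w, (searchProgram I c).Reaches B (searchConfig 13 v x s y z) e →
      (searchProgram I c).Reaches B (searchConfig 13 w x s y z) e := by
    intro v w h
    rcases h.cases_head with h | ⟨d, h, h'⟩
    · rw [← h] at he
      exact absurd he (by norm_num [searchConfig])
    · rw [hstep] at h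
      exact .head ((hstep w).trans h) h'
  exact ⟨key v 0, key 0 v⟩

/-- A problem consisting of algebraic reals is reducible to every larger one. -/
theorem reducible_singletons {S T : Set ℝ} (hS : ∀ a ∈ S, IsAlgebraic ℚ a) (hne : S.Nonempty)
    (hTS : T ⊆ S) : Reducible (singletons T) (singletons S) := by
  obtain ⟨s, hs⟩ := exists_search (T := T) hS hne
  -- The oracle lets only members of `S` into the search, which then terminates; all other inputs
  -- are rejected, correctly since `T ⊆ S`.
  refine ⟨searchProgram (.query 10) s, fun w => ?_⟩
  by_cases hw : w ∈ singletons S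
  · obtain ⟨x, hx, rfl⟩ := hw
    obtain ⟨e, he, hl, hword⟩ := (hs (.query 10) s (singletons S) x).1 hx
    have hout : (searchProgram (.query 10) s).HaltsIn (singletons S) [x] e := by
      refine ⟨.head (step_query_mem rfl (word_init [x]) (singleton_mem_singletons.2 hx)) ?_, hl.ge⟩
      refine (search_init (x := x) (v := 1) (by simp) fun k h0 _ _ => ?_).trans
        ((search_reaches_iff hl.ge).2 he)
      change (Config.init [x]).reg k = _
      rw [init_singleton]
      simp [h0]
    rw [singleton_mem_singletons]
    constructor
    · intro h
      exact ⟨e, hout, by rw [hword, if_pos h]⟩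
    · intro h
      exact ⟨e, hout, by rw [hword, if_neg h]⟩
  · constructor
    · rintro ⟨x, hx, rfl⟩
      exact absurd ⟨x, hTS hx, rfl⟩ hw
    · intro _
      obtain ⟨e, he, hl, hword⟩ := search_reject (I := .query 10) (c := s) (B := singletons S)
        (i := 1) (j := 1) (ρ := (Config.init w).reg)
      exact ⟨e, ⟨.head (step_query_notMem rfl (word_init w) hw) he, hl.ge⟩, hword⟩

/-- A problem consisting of algebraic reals is semi-decidable. -/
theorem semidecidable_singletons {S : Set ℝ} (hS : ∀ a ∈ S, IsAlgebraic ℚ a) (hne : S.Nonempty) :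
    Semidecidable (singletons S) := by
  obtain ⟨s, hs⟩ := exists_search (T := S) hS hne
  refine ⟨searchProgram (.branch 4) s, ?_, fun w => ?_⟩
  · intro t
    simp [searchProgram]
  let l : ℝ := w.length
  let ρ₁ : ℤ → ℝ := Function.update (Config.init w).reg (-5) 1
  let ρ₂ : ℤ → ℝ := Function.update ρ₁ 0 (l - 1)
  let ρ₃ : ℤ → ℝ := Function.update ρ₂ (-2) ((l - 1) * (l - 1))
  let ρ₄ : ℤ → ℝ := Function.update ρ₃ 0 (0 - (l - 1) * (l - 1))
  have hreach : (searchProgram (.branch 4) s).Reaches ∅ (Config.init w) ⟨8, 1, 1, ρ₄⟩ :=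
    .head (step_branch_pos rfl (Nat.cast_nonneg w.length)) <| .head (step_const rfl) <|
      .head (step_arith rfl rfl) <| .head (step_arith rfl rfl) <| .head (step_arith rfl rfl) .refl
  have h0 : ρ₄ 0 = 0 - (l - 1) * (l - 1) := Function.update_self ..
  by_cases hw : w.length = 1
  · obtain ⟨x, rfl⟩ := List.length_eq_one_iff.1 hw
    have hl : l = 1 := by simp [l]
    rw [hl, sub_self, mul_zero, sub_zero] at h0
    have hreach2 := (hreach.tail (step_branch_pos rfl h0.ge)).trans
      (search_init (x := x) h0 fun k hk0 hk2 hk5 => by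
        simp only [ρ₄, ρ₃, ρ₂, ρ₁, Function.update_of_ne hk0, Function.update_of_ne hk2,
          Function.update_of_ne hk5, init_singleton]
        simp [hk0])
    rw [halts_iff_of_reaches hreach2 (by norm_num [searchConfig, searchProgram]),
      singleton_mem_singletons]
    constructor
    · rintro ⟨d, hd, hdl⟩
      by_contra hx
      exact (hs (.branch 4) s ∅ x).2 hx d hdl hd
    · intro hx
      obtain ⟨e, he, hle, -⟩ := (hs (.branch 4) s ∅ x).1 hx
      exact ⟨e, he, hle.ge⟩
  · have hneg : ρ₄ 0 < 0 := by
      have : l - 1 ≠ 0 := by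
        rw [sub_ne_zero]
        simpa [l] using hw
      rw [h0, zero_sub, neg_lt_zero]
      exact mul_self_pos.2 this
    refine iff_of_false ?_ ?_
    · rw [halts_iff_of_reaches (hreach.tail (step_branch_neg rfl hneg))
        (by norm_num [searchProgram])]
      rintro ⟨d, hd, hdl⟩
      rcases hd.cases_head with h | ⟨e, h, -⟩
      · rw [← h] at hdl
        exact absurd hdl (by norm_num [searchProgram])
      · rw [step_div_zero rfl] at h
        · cases h
        · simp [ρ₄, ρ₃, ρ₂, ρ₁, Config.init]
    · rintro ⟨x, -, rfl⟩
      exact hw rfl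

end Search

theorem Reducible.refl (A : Problem) : Reducible A A := by
  refine ⟨[.query 4, .const 0 1 .keep .keep, .const 1 0 .keep .keep, .branch 6,
    .const 0 1 .keep .keep, .const 1 1 .keep .keep], fun x => ⟨fun hx => ?_, fun hx => ?_⟩⟩
  · refine ⟨_, ⟨.head (step_query_mem rfl (word_init x) hx) <| .head (step_const rfl) <|
      .head (step_const rfl) .refl, le_rfl⟩, ?_⟩
    simp [word_eq_singleton]
  · refine ⟨_, ⟨.head (step_query_notMem rfl (word_init x) hx) <| .head (step_const rfl) <|
      .head (step_const rfl) <| .head (step_branch_pos rfl ?_) .refl, le_rfl⟩, ?_⟩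
    · simp
    · simp [word_eq_singleton]

/-! ### Reduction to the Halting Problem -/

section Halting

open Relation

theorem ArithOp.code_injective : Function.Injective ArithOp.code := by
  intro o o' h
  cases o <;> cases o' <;> first | rfl | norm_num [ArithOp.code] at h

theorem ArithOp.code_le (o : ArithOp) : o.code ≤ 4 := by
  cases o <;> norm_num [ArithOp.code]

theorem IndexOp.code_injective : Function.Injective IndexOp.code := by
  intro o o' h
  cases o <;> cases o' <;> first | rfl | norm_num [IndexOp.code] at h

theorem Instr.code_injective : Function.Injective Instr.code := by
  intro I J h
  cases I with
  | arith o s k l u v =>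
    have ho := o.code_le
    cases J with
    | arith o' s' k' l' u' v' =>
      simp only [Instr.code, List.cons.injEq, Int.cast_inj, and_true] at h
      obtain ⟨h1, rfl, rfl, rfl, h2, h3⟩ := h
      rw [ArithOp.code_injective h1, IndexOp.code_injective h2, IndexOp.code_injective h3]
    | _ =>
      simp only [Instr.code, List.cons.injEq] at h
      linarith [h.1]
  | const s a u v =>
    cases J with
    | const s' a' u' v' =>
      simp only [Instr.code, List.cons.injEq, Int.cast_inj, and_true, true_and] at h
      obtain ⟨rfl, rfl, h2, h3⟩ := h
      rw [IndexOp.code_injective h2, IndexOp.code_injective h3]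
    | arith o' s' k' l' u' v' =>
      have ho := o'.code_le
      simp only [Instr.code, List.cons.injEq] at h
      linarith [h.1]
    | _ => norm_num [Instr.code] at h
  | branch t =>
    cases J with
    | arith o' s' k' l' u' v' =>
      have ho := o'.code_le
      simp only [Instr.code, List.cons.injEq] at h
      linarith [h.1]
    | branch t' => simpa [Instr.code] using h
    | _ => norm_num [Instr.code] at h
  | copy =>
    cases J with
    | arith o' s' k' l' u' v' =>
      have ho := o'.code_le
      simp only [Instr.code, List.cons.injEq] at h
      linarith [h.1]
    | copy => rfl
    | _ => norm_num [Instr.code] at h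
  | query t =>
    cases J with
    | arith o' s' k' l' u' v' =>
      have ho := o'.code_le
      simp only [Instr.code, List.cons.injEq] at h
      linarith [h.1]
    | query t' => simpa [Instr.code] using h
    | _ => norm_num [Instr.code] at h

theorem Instr.length_code (I : Instr) : I.code.length = 6 := by
  cases I <;> rfl

theorem Program.length_flatMap_code (p : Program) : (p.flatMap Instr.code).length = p.length * 6 := by
  induction p with
  | nil => rfl
  | cons I p ih => rw [List.flatMap_cons, List.length_append, ih, I.length_code, List.length_cons]; ring

theorem Program.flatMap_code_inj {p q : Program} (h : p.flatMap Instr.code = q.flatMap Instr.code) :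
    p = q := by
  induction p generalizing q with
  | nil =>
    cases q with
    | nil => rfl
    | cons J q => cases J <;> simp [Instr.code] at h
  | cons I p ih =>
    cases q with
    | nil => cases I <;> simp [Instr.code] at h
    | cons J q =>
      rw [List.flatMap_cons, List.flatMap_cons] at h
      obtain ⟨h1, h2⟩ := List.append_inj h (by rw [I.length_code, J.length_code])
      rw [Instr.code_injective h1, ih h2]

/-- Codes of machines are self-delimiting. -/
theorem Program.code_append_inj {p q : Program} {x y : List ℝ} (h : p.code ++ x = q.code ++ y) :
    p = q ∧ x = y := by
  simp only [Program.code, List.cons_append, List.cons.injEq, Nat.cast_inj] at h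
  obtain ⟨h, hxy⟩ := List.append_inj h.2
    (by rw [Program.length_flatMap_code, Program.length_flatMap_code, h.1])
  exact ⟨Program.flatMap_code_inj h, hxy⟩

/-- A machine which puts the sequence `a` in front of an input of size one, and asks the oracle. -/
def prependProgram (a : List ℝ) : Program :=
  [.const (-5) 1 .keep .keep, .arith .sub 0 0 (-5) .keep .keep, .arith .mul (-2) 0 0 .keep .keep,
    .arith .sub 0 (-1) (-2) .keep .keep, .branch 8,
    .const 0 1 .keep .keep, .const 1 0 .keep .keep, .branch (a.length + 14),
    -- The input is moved behind the future prefix before register `1` may be overwritten, and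
    -- register `0` receives the new size.
    .arith .add (a.length + 1) 1 (-1) .keep .keep, .const 0 (a.length + 1) .keep .keep] ++
  (List.ofFn fun k : Fin a.length => Instr.const ((k : ℤ) + 1) a[k] .keep .keep) ++
  [.query (a.length + 12), .branch 5, .const 0 1 .keep .keep, .const 1 1 .keep .keep]

variable {a : List ℝ} {B : Problem}

theorem length_prependProgram : (prependProgram a).length = a.length + 14 := by
  simp [prependProgram]

theorem getElem?_prependProgram_const {k : ℕ} (hk : k < a.length) :
    (prependProgram a)[10 + k]? = some (.const ((k : ℤ) + 1) a[k] .keep .keep) := by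
  rw [prependProgram, List.append_assoc, List.getElem?_append_right (by simp)]
  rw [List.getElem?_append_left (by simpa)]
  simp [hk]

theorem getElem?_prependProgram_tail (k : ℕ) :
    (prependProgram a)[a.length + 10 + k]? =
      [Instr.query (a.length + 12), .branch 5, .const 0 1 .keep .keep, .const 1 1 .keep .keep][k]? := by
  rw [prependProgram, List.getElem?_append_right (by simp)]
  congr 1
  simp

theorem prepend_write (ρ : ℤ → ℝ) {m : ℕ} (hm : m ≤ a.length) :
    (prependProgram a).Reaches B ⟨10, 1, 1, ρ⟩
      ⟨10 + m, 1, 1, fun z => if 1 ≤ z ∧ z ≤ m then a.getD (z.toNat - 1) 0 else ρ z⟩ := by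
  induction m with
  | zero =>
    have : (fun z : ℤ => if 1 ≤ z ∧ z ≤ ((0 : ℕ) : ℤ) then a.getD (z.toNat - 1) 0 else ρ z) = ρ := by
      funext z
      rw [if_neg (by simp; omega)]
    rw [this]
  | succ m ih =>
    refine (ih (by omega)).tail ?_
    rw [step_const (getElem?_prependProgram_const (by omega : m < a.length))]
    refine congrArg some ?_
    ext1
    · rfl
    · rfl
    · rfl
    · funext z
      simp only [Function.update_apply]
      by_cases hz : z = (m : ℤ) + 1
      · subst hz
        rw [if_pos rfl, if_pos (by push_cast; omega)]
        have : ((m : ℤ) + 1).toNat - 1 = m := by omega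
        rw [this, List.getD_eq_getElem?_getD, List.getElem?_eq_getElem (by omega)]
        rfl
      · rw [if_neg hz]
        refine if_congr ?_ rfl rfl
        push_cast
        omega

theorem prepend_reject {n : ℕ} (hn : n = 5) (ρ : ℤ → ℝ) :
    ∃ d, (prependProgram a).Reaches B ⟨n, 1, 1, ρ⟩ d ∧ d.label = a.length + 14 ∧
      d.word = some [0] := by
  subst hn
  refine ⟨⟨a.length + 14, 1, 1, Function.update (Function.update ρ 0 1) 1 0⟩,
    .head (step_const rfl) (.head (step_const rfl) (.head (step_branch_pos rfl ?_) .refl)), rfl, ?_⟩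
  · simp
  · simp [word_eq_singleton]

theorem reducible_of_prepend {S : Set ℝ} (h : ∀ x, a ++ [x] ∈ B ↔ x ∈ S) :
    Reducible (singletons S) B := by
  refine ⟨prependProgram a, fun w => ?_⟩
  let l : ℝ := w.length
  let ρ₁ : ℤ → ℝ := Function.update (Config.init w).reg (-5) 1
  let ρ₂ : ℤ → ℝ := Function.update ρ₁ 0 (l - 1)
  let ρ₃ : ℤ → ℝ := Function.update ρ₂ (-2) ((l - 1) * (l - 1))
  let ρ₄ : ℤ → ℝ := Function.update ρ₃ 0 (0 - (l - 1) * (l - 1))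
  have hreach : (prependProgram a).Reaches B (Config.init w) ⟨4, 1, 1, ρ₄⟩ :=
    .head (step_const rfl) <| .head (step_arith rfl rfl) <| .head (step_arith rfl rfl) <|
      .head (step_arith rfl rfl) .refl
  have h0 : ρ₄ 0 = 0 - (l - 1) * (l - 1) := Function.update_self ..
  by_cases hw : w.length = 1
  · obtain ⟨x, rfl⟩ := List.length_eq_one_iff.1 hw
    have hl : l = 1 := by simp [l]
    rw [hl, sub_self, mul_zero, sub_zero] at h0
    have h1 : ρ₄ 1 + ρ₄ (-1) = x := by
      simp [ρ₄, ρ₃, ρ₂, ρ₁, init_singleton]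
    let ρ₅ : ℤ → ℝ := Function.update (Function.update ρ₄ (a.length + 1) x) 0 (a.length + 1)
    let ρ₆ : ℤ → ℝ := fun z => if 1 ≤ z ∧ z ≤ (a.length : ℤ) then a.getD (z.toNat - 1) 0 else ρ₅ z
    have hreach2 : (prependProgram a).Reaches B (Config.init [x])
        ⟨a.length + 10, 1, 1, ρ₆⟩ := by
      rw [add_comm a.length 10]
      refine (hreach.tail (step_branch_pos rfl h0.ge)).trans ?_
      exact .head (step_arith rfl (congrArg some h1)) <| .head (step_const rfl) <|
        prepend_write ρ₅ le_rfl
    have h60 : ρ₆ 0 = ((a.length + 1 : ℕ) : ℝ) := by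
      simp [ρ₆, ρ₅]
    have hword : (⟨a.length + 10, 1, 1, ρ₆⟩ : Config).word = some (a ++ [x]) := by
      refine word_eq_some (by simp [h60]) fun m hm => ?_
      have hm1 : m < a.length + 1 := by simpa using hm
      simp only [ρ₆]
      by_cases hma : m < a.length
      · rw [if_pos (by omega), List.getElem_append_left hma]
        have : ((m : ℤ) + 1).toNat - 1 = m := by omega
        rw [this, List.getD_eq_getElem?_getD, List.getElem?_eq_getElem hma]
        rfl
      · obtain rfl : m = a.length := by omega
        rw [if_neg (by omega), List.getElem_append_right le_rfl]
        simp only [ρ₅]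
        rw [Function.update_of_ne (by omega), Function.update_self]
        simp
    rw [singleton_mem_singletons, ← h x]
    constructor
    · intro hx
      refine ⟨_, ⟨(hreach2.tail (step_query_mem (getElem?_prependProgram_tail 0) hword hx)).trans <|
        .head (step_const (getElem?_prependProgram_tail 2)) <|
        .head (step_const (getElem?_prependProgram_tail 3)) .refl, ?_⟩, ?_⟩
      · rw [length_prependProgram]
      · simp [word_eq_singleton]
    · intro hx
      obtain ⟨e, he, hle, hwe⟩ := prepend_reject (a := a) (B := B) rfl ρ₆
      refine ⟨e, ⟨((hreach2.tail
        (step_query_notMem (getElem?_prependProgram_tail 0) hword hx)).tail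
        (step_branch_pos (getElem?_prependProgram_tail 1) ?_)).trans he, ?_⟩, hwe⟩
      · rw [h60]; positivity
      · rw [length_prependProgram, hle]
  · have hneg : ρ₄ 0 < 0 := by
      have : l - 1 ≠ 0 := by
        rw [sub_ne_zero]
        simpa [l] using hw
      rw [h0, zero_sub, neg_lt_zero]
      exact mul_self_pos.2 this
    constructor
    · rintro ⟨x, -, rfl⟩
      exact absurd rfl hw
    · intro _
      obtain ⟨e, he, hle, hwe⟩ := prepend_reject (a := a) (B := B) rfl ρ₄
      refine ⟨e, ⟨(hreach.tail (step_branch_neg rfl hneg)).trans he, ?_⟩, hwe⟩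
      rw [length_prependProgram, hle]

/-- Semi-decidable sets of reals are reducible to the Halting Problem. -/
theorem Semidecidable.reducible_haltingProblem {S : Set ℝ} (h : Semidecidable (singletons S)) :
    Reducible (singletons S) haltingProblem := by
  obtain ⟨p, hp, hS⟩ := h
  -- The code of the fixed machine is a finite list of reals, so it can be built into the reduction
  -- as constants.
  refine reducible_of_prepend (a := p.code) fun x => ?_
  rw [← singleton_mem_singletons, ← hS [x]]
  constructor
  · rintro ⟨q, y, hq, -, hhalt⟩
    obtain ⟨rfl, rfl⟩ := Program.code_append_inj hq
    exact hhalt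
  · exact fun h => ⟨p, [x], rfl, hp, h⟩

end Halting

/-! ### Degrees of fields of radicals -/

theorem isAlgebraic_of_mem_radicalField {P : Set Nat.Primes} {x : ℝ}
    (hx : x ∈ (radicalField P : Set ℝ)) : IsAlgebraic ℚ x :=
  mem_algebraicClosure_iff.1 (radicalField_le_algebraicClosure P hx)

theorem semidecidable_radicalProblem (P : Set Nat.Primes) : Semidecidable (radicalProblem P) :=
  semidecidable_singletons (fun _ => isAlgebraic_of_mem_radicalField) ⟨0, zero_mem _⟩

theorem reducible_radicalProblem_iff {P Q : Set Nat.Primes} :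
    Reducible (radicalProblem P) (radicalProblem Q) ↔ P ⊆ Q :=
  ⟨fun h => subset_of_reducible_chain (.refl _) (.refl _) (.refl _) h,
    fun h => reducible_singletons (fun _ => isAlgebraic_of_mem_radicalField) ⟨0, zero_mem _⟩
      (radicalField_mono h)⟩

theorem reducible_radicalProblem_haltingProblem (P : Set Nat.Primes) :
    Reducible (radicalProblem P) haltingProblem :=
  (semidecidable_radicalProblem P).reducible_haltingProblem

theorem mem_degree_self (A : Problem) : A ∈ (degree A).1 := ⟨.refl A, .refl A⟩

theorem degree_le_degree_of_reducible {A B : Problem} (h : Reducible A B) : degree A ≤ degree B :=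
  ⟨A, mem_degree_self A, B, mem_degree_self B, h⟩

/-- Inequality of degrees provides reductions between unspecified representatives; the resulting
chain is composed generically. -/
theorem degree_radicalProblem_le_iff {P Q : Set Nat.Primes} :
    degree (radicalProblem P) ≤ degree (radicalProblem Q) ↔ P ⊆ Q := by
  refine ⟨?_, fun h => degree_le_degree_of_reducible (reducible_radicalProblem_iff.2 h)⟩
  rintro ⟨A, hA, B, hB, h⟩
  exact subset_of_reducible_chain (.refl _) hA.1 h hB.2

theorem degree_radicalProblem_injective :
    Function.Injective fun P : Set Nat.Primes => degree (radicalProblem P) := by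
  intro P Q h
  have h' : degree (radicalProblem P) = degree (radicalProblem Q) := h
  have hle : degree (radicalProblem P) ≤ degree (radicalProblem P) :=
    degree_radicalProblem_le_iff.2 subset_rfl
  exact Set.Subset.antisymm (degree_radicalProblem_le_iff.1 (h' ▸ hle))
    (degree_radicalProblem_le_iff.1 (h' ▸ hle))

theorem isRE_degree_radicalProblem (P : Set Nat.Primes) : (degree (radicalProblem P)).IsRE :=
  ⟨_, mem_degree_self _, semidecidable_radicalProblem P⟩

/-- The field of all primes also lies below the Halting Problem. A reduction of the latter to `F_P`
would therefore force `P` to contain every prime. -/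
theorem degree_radicalProblem_lt {P : Set Nat.Primes} (hP : P ≠ Set.univ) :
    degree (radicalProblem P) < degree haltingProblem := by
  refine ⟨degree_le_degree_of_reducible (reducible_radicalProblem_haltingProblem P), ?_⟩
  rintro ⟨A, hA, B, hB, h⟩
  exact hP (Set.univ_subset_iff.1 (subset_of_reducible_chain
    (reducible_radicalProblem_haltingProblem Set.univ) hA.1 h hB.2))

/-! ### Partial orders and antichains coded by sets of primes -/

/-- The prime number of index `n`. -/
def nthPrime (n : ℕ) : Nat.Primes := ⟨Nat.nth Nat.Prime n, Nat.prime_nth_prime n⟩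

theorem nthPrime_inj {m n : ℕ} : nthPrime m = nthPrime n ↔ m = n := by
  exact Subtype.ext_iff.trans (Nat.nth_injective Nat.infinite_setOfPred_prime).eq_iff

/-- Independent sets of primes: one prime of every pair is chosen. -/
def primeChoice (S : Set ℕ) : Set Nat.Primes :=
  {q | ∃ n, (n ∈ S ∧ q = nthPrime (2 * n)) ∨ (n ∉ S ∧ q = nthPrime (2 * n + 1))}

theorem nthPrime_even_mem_primeChoice {S : Set ℕ} {n : ℕ} :
    nthPrime (2 * n) ∈ primeChoice S ↔ n ∈ S := by
  constructor
  · rintro ⟨m, ⟨hm, h⟩ | ⟨-, h⟩⟩ <;> rw [nthPrime_inj] at h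
    · rwa [show n = m by omega]
    · omega
  · exact fun h => ⟨n, .inl ⟨h, rfl⟩⟩

theorem nthPrime_odd_mem_primeChoice {S : Set ℕ} {n : ℕ} :
    nthPrime (2 * n + 1) ∈ primeChoice S ↔ n ∉ S := by
  constructor
  · rintro ⟨m, ⟨-, h⟩ | ⟨hm, h⟩⟩ <;> rw [nthPrime_inj] at h
    · omega
    · rwa [show n = m by omega]
  · exact fun h => ⟨n, .inr ⟨h, rfl⟩⟩

/-- Membership and nonmembership of `n` are each witnessed by a prime, so inclusion transfers both.
-/
theorem primeChoice_subset_iff {S T : Set ℕ} : primeChoice S ⊆ primeChoice T ↔ S = T := by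
  refine ⟨fun h => Set.ext fun n => ⟨fun hn => ?_, fun hn => ?_⟩, fun h => h ▸ subset_rfl⟩
  · exact nthPrime_even_mem_primeChoice.1 (h (nthPrime_even_mem_primeChoice.2 hn))
  · by_contra hS
    exact nthPrime_odd_mem_primeChoice.1 (h (nthPrime_odd_mem_primeChoice.2 hS)) hn

theorem primeChoice_ne_univ (S : Set ℕ) : primeChoice S ≠ Set.univ := by
  intro h
  exact nthPrime_odd_mem_primeChoice.1 (h ▸ Set.mem_univ (nthPrime (2 * 0 + 1)))
    (nthPrime_even_mem_primeChoice.1 (h ▸ Set.mem_univ (nthPrime (2 * 0))))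

/-- Every countable partial order embeds into the recursively enumerable degrees. -/
theorem nonempty_orderEmbedding_degree (α : Type*) [PartialOrder α] [Countable α] :
    Nonempty (α ↪o {d : Degree // d.IsRE}) := by
  obtain ⟨f, hf⟩ := exists_injective_nat α
  -- One prime is assigned to each element, and `a` is represented by the primes of its lower set.
  let P : α → Set Nat.Primes := fun a => {q | ∃ b ≤ a, q = nthPrime (f b)}
  have hP : ∀ {a b : α}, P a ⊆ P b ↔ a ≤ b := by
    intro a b
    constructor
    · intro h
      obtain ⟨c, hc, hac⟩ := h ⟨a, le_rfl, rfl⟩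
      rwa [hf (nthPrime_inj.1 hac)]
    · rintro h _ ⟨c, hc, rfl⟩
      exact ⟨c, hc.trans h, rfl⟩
  refine ⟨⟨⟨fun a => ⟨degree (radicalProblem (P a)), isRE_degree_radicalProblem _⟩, ?_⟩, ?_⟩⟩
  · intro a b h
    have h' := degree_radicalProblem_injective (congrArg Subtype.val h)
    exact le_antisymm (hP.1 h'.subset) (hP.1 h'.superset)
  · intro a b
    exact degree_radicalProblem_le_iff.trans hP

/-- There are uncountably many pairwise incomparable degrees of fields of radicals strictly below
the Halting Problem. -/
theorem exists_uncountable_antichain :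
    ∃ D : Set Degree,
      D ⊆ Set.range (fun P : Set Nat.Primes => degree (radicalProblem P)) ∧
      ¬ D.Countable ∧
      (∀ d ∈ D, d.IsRE ∧ d < degree haltingProblem) ∧
      IsAntichain (· ≤ ·) D := by
  refine ⟨Set.range fun S => degree (radicalProblem (primeChoice S)), ?_, ?_, ?_, ?_⟩
  · rintro _ ⟨S, rfl⟩
    exact ⟨primeChoice S, rfl⟩
  · intro h
    have hinj : Function.Injective fun S => degree (radicalProblem (primeChoice S)) := fun S T hST =>
      primeChoice_subset_iff.1 (degree_radicalProblem_injective hST).subset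
    have := h.to_subtype
    have : Countable (Set ℕ) := (hinj.codRestrict fun S => Set.mem_range_self S).countable
    obtain ⟨f, hf⟩ := exists_injective_nat (Set ℕ)
    exact Function.cantor_injective f hf
  · rintro _ ⟨S, rfl⟩
    exact ⟨isRE_degree_radicalProblem _, degree_radicalProblem_lt (primeChoice_ne_univ S)⟩
  · rintro _ ⟨S, rfl⟩ _ ⟨T, rfl⟩ hne hle
    exact hne (by rw [primeChoice_subset_iff.1 (degree_radicalProblem_le_iff.1 hle)])

end BSS
end
theorem mainTheorem3 :
    (∀ P Q : Set Nat.Primes,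
      BSS.Reducible (BSS.radicalProblem P) (BSS.radicalProblem Q) ↔ P ⊆ Q) ∧
    (∀ P : Set Nat.Primes, BSS.Semidecidable (BSS.radicalProblem P)) ∧
    (∀ (α : Type*) [PartialOrder α] [Countable α],
      Nonempty (α ↪o {d : BSS.Degree // d.IsRE})) ∧
    (∃ D : Set BSS.Degree,
      D ⊆ Set.range (fun P : Set Nat.Primes => BSS.degree (BSS.radicalProblem P)) ∧
      ¬ D.Countable ∧
      (∀ d ∈ D, d.IsRE ∧ d < BSS.degree BSS.haltingProblem) ∧
      IsAntichain (· ≤ ·) D) :=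
  ⟨fun _ _ => BSS.reducible_radicalProblem_iff, BSS.semidecidable_radicalProblem,
    fun α _ _ => BSS.nonempty_orderEmbedding_degree α, BSS.exists_uncountable_antichain⟩
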